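/- Let $g$ be a smooth pseudo-Riemannian metric of arbitrary signature on $\mathbb{R}^m$ with its usual coordinates $x=(x_1,\dots,x_m)$ and coordinate frame $\partial_i=\partial_{x_i}$, let $\nabla$ be its Levi-Civita connection, and let $R(X,Y)=\nabla_X\nabla_Y-\nabla_Y\nabla_X-\nabla_{[X,Y]}$. Write $R_{i_1i_2i_3}{}^{k}{}_{;j_1\dots j_\nu}$ for the components of the $\nu$-th covariant derivative $\nabla^\nu R$ (with $k$ the component along $\partial_k$ of $R(\partial_{i_1},\partial_{i_2})\partial_{i_3}$ and $j_1,\dots,j_\nu$ the indices of differentiation). Suppose that $(\mathbb{R}^m,g)$ is a generalized plane wave manifold, i.e. for all $i,j$ $$\nabla_{\partial_i}\partial_j=\sum_{k>\max(i,j)}\Gamma_{ij}{}^k(x_1,\dots,x_{k-1})\,\partial_k .$$ Then: 1. $(\mathbb{R}^m,g)$ is complete (every geodesic defined on an open interval extends to a geodesic defined on $\mathbb{R}$) and strongly geodesically convex (for all $P,Q\in\mathbb{R}^m$ there is exactly one geodesic $\gamma:[0,1]\to\mathbb{R}^m$ with $\gamma(0)=P$ and $\gamma(1)=Q$). 2.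 For every $\nu\ge 0$ and all indices, $R_{i_1i_2i_3}{}^{k}{}_{;j_1\dots j_\nu}$ vanishes identically unless $k>\max(i_1,i_2,i_3,j_1,\dots,j_\nu)$, and it is a function of $x_1,\dots,x_{k-1}$ only. 3. $(\mathbb{R}^m,g)$ is nilpotent Osserman, nilpotent Ivanov–Petrova and nilpotent Szabó: for every tangent vector $\xi$ the Jacobi operator $J(\xi):y\mapsto R(y,\xi)\xi$ and the Szabó operator $\mathcal{S}(\xi):y\mapsto(\nabla_\xi R)(y,\xi)\xi$ satisfy $J(\xi)^m=0$ and $\mathcal{S}(\xi)^m=0$, and for every orthonormal basis $\{e_1,e_2\}$ of a spacelike or timelike tangent $2$-plane the operator $y\mapsto R(e_1,e_2)y$ has vanishing $m$-th power. 4. $(\mathbb{R}^m,g)$ is Ricci flat ($\rho_{ij}=\sum_kR_{kij}{}^k=0$) and Einstein ($\rho=c\,g$ for a constant $c$). 5. $(\mathbb{R}^m,g)$ is VSI: every scalar Weyl invariant vanishes identically, i.e. every full contraction of upper against lower indices in a product of at least one factor $R_{i_1i_2i_3}{}^{k}{}_{;j_1\dots j_\nu}$ ($\nu\ge0$ arbitrary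 for each factor) and any number of factors $g^{ij}$ and $g_{ij}$ is zero at every point. 6. If $\gamma:[0,1]\to\mathbb{R}^m$ is a smooth curve, then parallel transport along $\gamma$ is a well-defined linear isomorphism $P_\gamma:T_{\gamma(0)}\mathbb{R}^m\to T_{\gamma(1)}\mathbb{R}^m$, and for each $i$ there are real numbers $a^j$ with $P_\gamma\partial_i=\partial_i+\sum_{j>i}a^j\partial_j$. 7. The group $\mathcal{T}$ of real upper triangular $m\times m$ matrices with all diagonal entries $1$ is nilpotent, and for every point $P$ the holonomy group $\mathcal{H}_P$ (the group of the parallel transports along smooth loops at $P$) is contained in $\mathcal{T}$, where an automorphism $A$ of the tangent space is identified with the matrix $(T_{ij})$ given by $A\partial_i=\sum_jT_{ij}\partial_j$. -/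

import Mathlib

namespace GPW

open scoped ContDiff

noncomputable section

/-- The underlying space `ℝ^m` with its usual coordinates. Every tangent space is identified with
`ℝ^m` through the coordinate frame `∂_i`. -/
abbrev E (m : ℕ) : Type := Fin m → ℝ

/-- The coordinate vector `∂_i`. -/
def basisVec {m : ℕ} (i : Fin m) : E m := Pi.single i 1

/-- The partial derivative `∂_i f` at `x`. -/
def pd {m : ℕ} (i : Fin m) (f : E m → ℝ) (x : E m) : ℝ := fderiv ℝ f x (basisVec i)

/-- A smooth pseudo-Riemannian metric on `ℝ^m`, of arbitrary signature, through its components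
`g_{ij} = g(∂_i, ∂_j)`. -/
structure Metric (m : ℕ) where
  toMatrix : E m → Matrix (Fin m) (Fin m) ℝ
  smooth : ∀ i j, ContDiff ℝ ∞ (fun x => toMatrix x i j)
  symm : ∀ x, (toMatrix x).IsSymm
  nondeg : ∀ x, (toMatrix x).det ≠ 0

variable {m : ℕ}

/-- The inner product `g_x(u, v)`. -/
def Metric.inner (g : Metric m) (x u v : E m) : ℝ :=
  ∑ i, ∑ j, g.toMatrix x i j * u i * v j

/-- The Christoffel symbols of the Levi-Civita connection:
`∇_{∂_i} ∂_j = ∑ k, christoffel g i j k • ∂_k`. -/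
def christoffel (g : Metric m) (i j k : Fin m) (x : E m) : ℝ :=
  (1 / 2) * ∑ l, (g.toMatrix x)⁻¹ k l *
    (pd i (fun y => g.toMatrix y j l) x + pd j (fun y => g.toMatrix y i l) x
      - pd l (fun y => g.toMatrix y i j) x)

/-- `f` depends only on the coordinates `x_i` with `i < k`. -/
def DependsOnlyBelow (k : Fin m) (f : E m → ℝ) : Prop :=
  ∀ x y : E m, (∀ i, i < k → x i = y i) → f x = f y

/-- `∇_{∂_i} ∂_j = ∑_{k > max(i,j)} Γ_{ij}^k(x_1, …, x_{k-1}) ∂_k`. -/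
def IsGeneralizedPlaneWave (g : Metric m) : Prop :=
  ∀ i j k : Fin m,
    (k ≤ max i j → ∀ x, christoffel g i j k x = 0) ∧
    DependsOnlyBelow k (christoffel g i j k)

/-! ### Curves, geodesics, parallel transport -/

/-- The covariant derivative `∇_{γ'} X` of a vector field `X` along a curve `γ` with parameter
domain `s`. -/
def covDerivAlong (g : Metric m) (γ X : ℝ → E m) (s : Set ℝ) (t : ℝ) : E m := fun k =>
  derivWithin X s t k + ∑ i, ∑ j, christoffel g i j k (γ t) * derivWithin γ s t i * X t j

/-- `X` is a smooth parallel vector field along `γ`, with parameter domain `s`. -/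
def IsParallelOn (g : Metric m) (γ X : ℝ → E m) (s : Set ℝ) : Prop :=
  ContDiffOn ℝ ∞ X s ∧ ∀ t ∈ s, covDerivAlong g γ X s t = 0

/-- `γ` is a geodesic with parameter domain `s` (an open or a compact interval, or all of `ℝ`). -/
def IsGeodesicOn (g : Metric m) (γ : ℝ → E m) (s : Set ℝ) : Prop :=
  ContDiffOn ℝ ∞ γ s ∧ ∀ t ∈ s, covDerivAlong g γ (derivWithin γ s) s t = 0

/-- Every geodesic, defined on any open interval, extends to a geodesic defined on `ℝ`. -/
def IsComplete (g : Metric m) : Prop :=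
  ∀ (I : Set ℝ) (γ : ℝ → E m), IsOpen I → I.OrdConnected → IsGeodesicOn g γ I →
    ∃ γ' : ℝ → E m, IsGeodesicOn g γ' Set.univ ∧ Set.EqOn γ γ' I

/-- Any two points are joined by a unique geodesic `[0,1] → ℝ^m`. -/
def IsStronglyGeodesicallyConvex (g : Metric m) : Prop :=
  ∀ P Q : E m, ∃ γ : ℝ → E m,
    (IsGeodesicOn g γ (Set.Icc 0 1) ∧ γ 0 = P ∧ γ 1 = Q) ∧
    ∀ γ' : ℝ → E m, IsGeodesicOn g γ' (Set.Icc 0 1) → γ' 0 = P → γ' 1 = Q →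
      Set.EqOn γ' γ (Set.Icc 0 1)

/-- A smooth curve `γ : [0,1] → ℝ^m`. -/
def IsSmoothCurve (γ : ℝ → E m) : Prop := ContDiffOn ℝ ∞ γ (Set.Icc 0 1)

/-- `P` is the parallel transport `P_γ : T_{γ(0)} → T_{γ(1)}`: `P v = w` exactly if some parallel
vector field along `γ` takes the value `v` at `0` and the value `w` at `1`. -/
def IsParallelTransport (g : Metric m) (γ : ℝ → E m) (P : E m ≃ₗ[ℝ] E m) : Prop :=
  ∀ v w : E m,
    (∃ X : ℝ → E m, IsParallelOn g γ X (Set.Icc 0 1) ∧ X 0 = v ∧ X 1 = w) ↔ P v = w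

/-- The holonomy group at `p`, generated by the parallel transports along smooth loops at `p`. -/
def holonomyGroup (g : Metric m) (p : E m) : Subgroup (E m ≃ₗ[ℝ] E m) :=
  Subgroup.closure {P | ∃ γ : ℝ → E m, IsSmoothCurve γ ∧ γ 0 = p ∧ γ 1 = p ∧
    IsParallelTransport g γ P}

theorem unitri_mul {A B : Matrix (Fin m) (Fin m) ℝ}
    (hA : (∀ i j, j < i → A i j = 0) ∧ ∀ i, A i i = 1)
    (hB : (∀ i j, j < i → B i j = 0) ∧ ∀ i, B i i = 1) :
    (∀ i j, j < i → (A * B) i j = 0) ∧ ∀ i, (A * B) i i = 1 := by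
  have key : ∀ i j k, (j ≤ i) → k ≠ i → A i k * B k j = 0 := by
    intro i j k hji hk
    rcases lt_or_gt_of_ne hk with h | h
    · rw [hA.1 i k h, zero_mul]
    · rw [hB.1 k j (lt_of_le_of_lt hji h), mul_zero]
  constructor
  · intro i j h
    rw [Matrix.mul_apply, Finset.sum_eq_single i (fun k _ hk => key i j k h.le hk) (by simp),
      hB.1 i j h, mul_zero]
  · intro i
    rw [Matrix.mul_apply, Finset.sum_eq_single i (fun k _ hk => key i i k le_rfl hk) (by simp),
      hA.2, hB.2, mul_one]

theorem unitri_inv {A B : Matrix (Fin m) (Fin m) ℝ} (hAB : A * B = 1) (hBA : B * A = 1)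
    (hA : (∀ i j, j < i → A i j = 0) ∧ ∀ i, A i i = 1) :
    (∀ i j, j < i → B i j = 0) ∧ ∀ i, B i i = 1 := by
  have hB : B = A⁻¹ := (Matrix.inv_eq_right_inv hAB).symm
  let _ : Invertible A := ⟨B, hBA, hAB⟩
  have ht : Matrix.BlockTriangular B id := by
    rw [hB]
    exact Matrix.blockTriangular_inv_of_blockTriangular (fun i j h => hA.1 i j h)
  refine ⟨fun i j h => ht h, fun i => ?_⟩
  have h1 : (A * B) i i = 1 := by rw [hAB, Matrix.one_apply_eq]
  rw [Matrix.mul_apply, Finset.sum_eq_single i _ (by simp), hA.2, one_mul] at h1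
  · exact h1
  · intro k _ hk
    rcases lt_or_gt_of_ne hk with h | h
    · rw [hA.1 i k h, zero_mul]
    · rw [ht h, mul_zero]

/-- The group `𝒯` of upper triangular matrices with all diagonal entries equal to `1`. -/
def upperUnipotent (m : ℕ) : Subgroup (GL (Fin m) ℝ) where
  carrier := {A | (∀ i j, j < i → A.val i j = 0) ∧ ∀ i, A.val i i = 1}
  mul_mem' := fun hA hB => unitri_mul hA hB
  one_mem' := ⟨fun _ _ h => Matrix.one_apply_ne h.ne', fun i => Matrix.one_apply_eq i⟩
  inv_mem' := fun {A} hA => unitri_inv A.val_inv A.inv_val hA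

/-! ### Curvature and its covariant derivatives -/

/-- The components `R_{ijk}^l` of the curvature operator, `R(∂_i, ∂_j) ∂_k = ∑ l, R_{ijk}^l ∂_l`,
where `R(X, Y) = ∇_X ∇_Y - ∇_Y ∇_X - ∇_{[X, Y]}`. -/
def curvature (g : Metric m) (i j k l : Fin m) (x : E m) : ℝ :=
  pd i (christoffel g j k l) x - pd j (christoffel g i k l) x
    + ∑ n, (christoffel g i n l x * christoffel g j k n x
      - christoffel g j n l x * christoffel g i k n x)

/-- The covariant derivative of a tensor field with `n` lower indices and one upper index, given by
its components `T I k`; the index of differentiation becomes the last lower index. -/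
def covDeriv {n : ℕ} (g : Metric m) (T : (Fin n → Fin m) → Fin m → E m → ℝ) :
    (Fin (n + 1) → Fin m) → Fin m → E m → ℝ := fun J k x =>
  let I : Fin n → Fin m := fun a => J a.castSucc
  let j : Fin m := J (Fin.last n)
  pd j (T I k) x
    - ∑ a, ∑ r, christoffel g j (I a) r x * T (Function.update I a r) k x
    + ∑ r, christoffel g j r k x * T I r x

/-- The components of `∇^ν R`: `nablaR g ν I k` is `R_{i₁ i₂ i₃}^k_{; j₁ … j_ν}`, where `I` lists
the lower indices `i₁, i₂, i₃` followed by the `ν` indices of differentiation. -/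
def nablaR (g : Metric m) : (ν : ℕ) → (Fin (3 + ν) → Fin m) → Fin m → E m → ℝ
  | 0 => fun I k => curvature g (I (0 : Fin 3)) (I (1 : Fin 3)) (I (2 : Fin 3)) k
  | ν + 1 => covDeriv g (nablaR g ν)

/-- The matrix of the Jacobi operator `J(ξ) : y ↦ R(y, ξ) ξ` at `x`; its `i`-th column holds the
components of the image of `∂_i`. -/
def jacobiOp (g : Metric m) (x ξ : E m) : Matrix (Fin m) (Fin m) ℝ :=
  Matrix.of fun l i => ∑ j, ∑ k, curvature g i j k l x * ξ j * ξ k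

/-- The matrix of the Szabó operator `S(ξ) : y ↦ (∇_ξ R)(y, ξ) ξ` at `x`. -/
def szaboOp (g : Metric m) (x ξ : E m) : Matrix (Fin m) (Fin m) ℝ :=
  Matrix.of fun l i => ∑ j, ∑ k, ∑ n, nablaR g 1 ![i, j, k, n] l x * ξ j * ξ k * ξ n

/-- The matrix of the curvature operator `y ↦ R(e₁, e₂) y` at `x`. -/
def curvatureOp (g : Metric m) (x e₁ e₂ : E m) : Matrix (Fin m) (Fin m) ℝ :=
  Matrix.of fun l k => ∑ i, ∑ j, curvature g i j k l x * e₁ i * e₂ j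

/-- `e₁, e₂` is an orthonormal basis of a spacelike or of a timelike 2-plane at `x`. -/
def IsOrthonormalPair (g : Metric m) (x e₁ e₂ : E m) : Prop :=
  g.inner x e₁ e₂ = 0 ∧
    ((g.inner x e₁ e₁ = 1 ∧ g.inner x e₂ e₂ = 1) ∨ (g.inner x e₁ e₁ = -1 ∧ g.inner x e₂ e₂ = -1))

def IsNilpotentOsserman (g : Metric m) : Prop :=
  ∀ x ξ : E m, jacobiOp g x ξ ^ m = 0

def IsNilpotentSzabo (g : Metric m) : Prop :=
  ∀ x ξ : E m, szaboOp g x ξ ^ m = 0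

def IsNilpotentIvanovPetrova (g : Metric m) : Prop :=
  ∀ x e₁ e₂ : E m, IsOrthonormalPair g x e₁ e₂ → curvatureOp g x e₁ e₂ ^ m = 0

/-- The Ricci tensor `ρ_{ij} = ∑ k, R_{kij}^k`. -/
def ricci (g : Metric m) (i j : Fin m) (x : E m) : ℝ := ∑ k, curvature g k i j k x

def IsRicciFlat (g : Metric m) : Prop := ∀ i j x, ricci g i j x = 0

def IsEinstein (g : Metric m) : Prop :=
  ∃ c : ℝ, ∀ i j x, ricci g i j x = c * g.toMatrix x i j

/-! ### Scalar Weyl invariants -/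

/-- A complete contraction of a product of at least one factor `R_{i₁i₂i₃}^{i₄}_{;j₁…j_ν}` with any
number of factors `g^{ij}` and `g_{ij}`, in which every lower index is paired with an upper one. -/
structure WeylMonomial where
  /-- the number of curvature factors -/
  numR : ℕ
  numR_pos : 0 < numR
  /-- the number of covariant derivatives in each curvature factor -/
  order : Fin numR → ℕ
  /-- the number of factors `g^{ij}` -/
  numInv : ℕ
  /-- the number of factors `g_{ij}` -/
  numMet : ℕ
  /-- the pairing of the lower index slots with the upper index slots -/
  pairing : ((s : Fin numR) × Fin (3 + order s)) ⊕ (Fin numMet × Fin 2) ≃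
    Fin numR ⊕ (Fin numInv × Fin 2)

/-- The value at `x`: the sum over all assignments `f` of coordinate indices to the upper slots
(hence, through the pairing, to the lower slots). -/
def WeylMonomial.eval (Θ : WeylMonomial) (g : Metric m) (x : E m) : ℝ :=
  ∑ f : Fin Θ.numR ⊕ (Fin Θ.numInv × Fin 2) → Fin m,
    (∏ s : Fin Θ.numR,
      nablaR g (Θ.order s) (fun a => f (Θ.pairing (Sum.inl ⟨s, a⟩))) (f (Sum.inl s)) x) *
    (∏ b : Fin Θ.numInv, (g.toMatrix x)⁻¹ (f (Sum.inr (b, 0))) (f (Sum.inr (b, 1)))) *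
    (∏ c : Fin Θ.numMet, g.toMatrix x (f (Θ.pairing (Sum.inr (c, 0))))
      (f (Θ.pairing (Sum.inr (c, 1)))))

/-- Vanishing scalar invariants. -/
def IsVSI (g : Metric m) : Prop := ∀ (Θ : WeylMonomial) (x : E m), Θ.eval g x = 0

end

end GPW

/-!
The geodesic equation and the equation of parallel transport are triangular: the second,
respectively first, derivative of the `k`-th unknown depends on the earlier unknowns only, so both
are solved by successive integrations, for arbitrary initial or boundary data. The same
triangularity passes through the recursion defining `∇^ν R`: an upper index exceeds all lower
ones. Hence all operators built from `R` and `∇R` are strictly triangular, so nilpotent and trace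
free, and parallel transport preserves the coordinate flag and acts trivially on its quotients.

For the scalar Weyl invariants, fix a point and choose a unitriangular change of frame bringing
the Gram matrix to a Bruhat-type normal form: for some involution `σ`, the pairing of the `i`-th
and `j`-th vectors vanishes if `σ i < j`. Give the `i`-th frame vector the weight
`N ^ (σ i) - N ^ i` with `N` large. Then `g` and `g⁻¹` only have components of non-negative
weight, while by triangularity and the skew-symmetry `R_{ijkl} = -R_{ijlk}` the components of each
`∇^ν R` have positive weight. A complete contraction sees total weight `0` only, and therefore
vanishes.
-/

namespace GPW

open scoped ContDiff Matrix

variable {m : ℕ}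

/-! ### The group of unitriangular matrices -/

section Superdiagonal

variable {R : Type*}

/-- The filtration of the algebra of upper triangular matrices by superdiagonals: `A` vanishes
below its `n`-th superdiagonal. -/
def IsUpperTriangularFrom [Zero R] (n : ℕ) (A : Matrix (Fin m) (Fin m) R) : Prop :=
  ∀ i j : Fin m, (j : ℕ) < i + n → A i j = 0

namespace IsUpperTriangularFrom

variable {a b : ℕ} {A B : Matrix (Fin m) (Fin m) R}

theorem eq_zero [Zero R] (hA : IsUpperTriangularFrom m A) : A = 0 :=
  Matrix.ext fun i j => hA i j (by lia)

theorem zero [Zero R] : IsUpperTriangularFrom a (0 : Matrix (Fin m) (Fin m) R) :=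
  fun _ _ _ => rfl

theorem one [Zero R] [One R] : IsUpperTriangularFrom 0 (1 : Matrix (Fin m) (Fin m) R) :=
  fun _ _ h => Matrix.one_apply_ne' (Fin.ne_of_val_ne h.ne)

theorem add [AddZeroClass R] (hA : IsUpperTriangularFrom a A) (hB : IsUpperTriangularFrom a B) :
    IsUpperTriangularFrom a (A + B) := fun i j h => by
  rw [Matrix.add_apply, hA i j h, hB i j h, add_zero]

theorem sub [SubtractionMonoid R] (hA : IsUpperTriangularFrom a A)
    (hB : IsUpperTriangularFrom a B) : IsUpperTriangularFrom a (A - B) := fun i j h => by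
  rw [Matrix.sub_apply, hA i j h, hB i j h, sub_zero]

theorem mul [NonUnitalNonAssocSemiring R] (hA : IsUpperTriangularFrom a A)
    (hB : IsUpperTriangularFrom b B) : IsUpperTriangularFrom (a + b) (A * B) := fun i j h => by
  refine (Matrix.mul_apply ..).trans (Finset.sum_eq_zero fun k _ => ?_)
  by_cases hk : (k : ℕ) < i + a
  · rw [hA i k hk, zero_mul]
  · rw [hB k j (by lia), mul_zero]

theorem pow [Semiring R] (hA : IsUpperTriangularFrom 1 A) (n : ℕ) :
    IsUpperTriangularFrom n (A ^ n) := by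
  induction n with
  | zero => exact pow_zero A ▸ one
  | succ n ih => exact pow_succ A n ▸ ih.mul hA

end IsUpperTriangularFrom

theorem pow_eq_zero_of_strictly_lowerTriangular [CommSemiring R] {A : Matrix (Fin m) (Fin m) R}
    (hA : ∀ i j, i ≤ j → A i j = 0) : A ^ m = 0 := by
  have hT : IsUpperTriangularFrom 1 A.transpose := fun i j h => hA j i (Nat.lt_succ_iff.1 h)
  rw [← Matrix.transpose_eq_zero, Matrix.transpose_pow]
  exact (hT.pow m).eq_zero

end Superdiagonal

theorem commutator_sub_one {R : Type*} [Ring R] (a b : Rˣ) :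
    (↑(a * b * a⁻¹ * b⁻¹) - 1 : R) =
      ((a - 1) * (b - 1) - (b - 1) * (a - 1)) * ↑(a⁻¹ * b⁻¹) := by
  have h : ((a - 1) * (b - 1) - (b - 1) * (a - 1) : R) = ↑(a * b) - ↑(b * a) := by
    push_cast
    noncomm_ring
  rw [h, sub_mul, ← Units.val_mul, ← Units.val_mul, show b * a * (a⁻¹ * b⁻¹) = 1 by group,
    Units.val_one, mul_assoc (a * b)]

section Unipotent

theorem isUpperTriangularFrom_zero_of_mem {A : GL (Fin m) ℝ} (hA : A ∈ upperUnipotent m) :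
    IsUpperTriangularFrom 0 A.val := hA.1

theorem isUpperTriangularFrom_one_of_mem {A : GL (Fin m) ℝ} (hA : A ∈ upperUnipotent m) :
    IsUpperTriangularFrom 1 (A.val - 1) := fun i j h => by
  rcases (Nat.lt_succ_iff.1 h).lt_or_eq with h | h
  · rw [Matrix.sub_apply, hA.1 i j h, Matrix.one_apply_ne' (Fin.ne_of_val_ne h.ne), sub_zero]
  · rw [Fin.ext h, Matrix.sub_apply, hA.2, Matrix.one_apply_eq, sub_self]

/-- The terms `{A | A - 1 vanishes below the n-th superdiagonal}` of a descending central series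
of `upperUnipotent m`. -/
def superdiagonalSubgroup (m n : ℕ) : Subgroup (upperUnipotent m) where
  carrier := {A | IsUpperTriangularFrom n (A.val.val - 1)}
  mul_mem' {A B} hA hB := by
    have h : (A * B).val.val - 1 = (A.val.val - 1) * B.val.val + (B.val.val - 1) := by
      rw [sub_mul, one_mul, sub_add_sub_cancel, Subgroup.coe_mul, Units.val_mul]
    exact Set.mem_ofPred.2 (h ▸ (hA.mul (isUpperTriangularFrom_zero_of_mem B.2)).add hB)
  one_mem' := Set.mem_ofPred.2 ((sub_self (1 : Matrix (Fin m) (Fin m) ℝ)).symm ▸ .zero)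
  inv_mem' {A} hA := by
    have h : (A⁻¹).val.val - 1 = 0 - (A⁻¹).val.val * (A.val.val - 1) := by
      rw [mul_sub, mul_one, zero_sub, neg_sub, Subgroup.coe_inv, Units.inv_mul]
    have hmul := (isUpperTriangularFrom_zero_of_mem (A⁻¹).2).mul hA
    exact Set.mem_ofPred.2 (h ▸ IsUpperTriangularFrom.zero.sub ((zero_add n) ▸ hmul))

theorem isNilpotent_upperUnipotent (m : ℕ) : Group.IsNilpotent (upperUnipotent m) := by
  rw [Subgroup.nilpotent_iff_finite_descending_central_series]
  refine ⟨m, superdiagonalSubgroup m, ⟨eq_top_iff.2 fun A _ i j h => ?_, fun A n hA B => ?_⟩,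
    eq_bot_iff.2 fun A hA => ?_⟩
  · exact isUpperTriangularFrom_one_of_mem A.2 i j (by lia)
  · change IsUpperTriangularFrom (n + 1) ((A.val * B.val * A.val⁻¹ * B.val⁻¹).val - 1)
    have hB := isUpperTriangularFrom_one_of_mem B.2
    have hcomm := (hA.mul hB).sub (add_comm n 1 ▸ hB.mul hA)
    have hprod := hcomm.mul (isUpperTriangularFrom_zero_of_mem (A⁻¹ * B⁻¹).2)
    exact commutator_sub_one A.val B.val ▸ hprod
  · exact Subgroup.mem_bot.2 (Subtype.ext (Units.ext (sub_eq_zero.1 hA.eq_zero)))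

theorem exists_mem_upperUnipotent_val_eq {T : Matrix (Fin m) (Fin m) ℝ}
    (hT : T.IsUpperTriangular) (hdiag : ∀ i, T i i = 1) : ∃ U ∈ upperUnipotent m, U.val = T := by
  have hdet : T.det = 1 := by
    simp only [Matrix.det_of_isUpperTriangular hT, hdiag, Finset.prod_const_one]
  exact ⟨.mkOfDetNeZero T (hdet ▸ one_ne_zero), ⟨fun _ _ h => hT h, hdiag⟩, rfl⟩

end Unipotent

/-! ### Partial derivatives and smoothness of the curvature -/

theorem pd_add {f h : E m → ℝ} {x : E m} (hf : DifferentiableAt ℝ f x)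
    (hh : DifferentiableAt ℝ h x) (i : Fin m) :
    pd i (fun y => f y + h y) x = pd i f x + pd i h x :=
  congr($(fderiv_fun_add hf hh) (basisVec i))

theorem pd_mul {f h : E m → ℝ} {x : E m} (hf : DifferentiableAt ℝ f x)
    (hh : DifferentiableAt ℝ h x) (i : Fin m) :
    pd i (fun y => f y * h y) x = f x * pd i h x + h x * pd i f x :=
  congr($(fderiv_fun_mul hf hh) (basisVec i))

theorem pd_sum {ι : Type*} (s : Finset ι) {f : ι → E m → ℝ} {x : E m}
    (hf : ∀ a ∈ s, DifferentiableAt ℝ (f a) x) (i : Fin m) :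
    pd i (fun y => ∑ a ∈ s, f a y) x = ∑ a ∈ s, pd i (f a) x :=
  congr($(fderiv_fun_sum hf) (basisVec i)).trans (sum_apply ..)

theorem pd_zero (i : Fin m) : pd i (0 : E m → ℝ) = 0 :=
  funext fun x => congr($(fderiv_zero (𝕜 := ℝ)) x (basisVec i))

theorem pd_comm {f : E m → ℝ} (hf : ContDiff ℝ 2 f) (i j : Fin m) :
    pd i (pd j f) = pd j (pd i f) := by
  funext x
  have hd : DifferentiableAt ℝ (fderiv ℝ f) x :=
    (hf.fderiv_right (m := 1) le_rfl).differentiable one_ne_zero x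
  have key (a b : Fin m) :
      pd a (pd b f) x = fderiv ℝ (fderiv ℝ f) x (basisVec a) (basisVec b) := by
    change fderiv ℝ (fun y => fderiv ℝ f y (basisVec b)) x (basisVec a) = _
    simp [fderiv_clm_apply hd (differentiableAt_const _)]
  have hsymm : IsSymmSndFDerivAt ℝ f x := hf.contDiffAt.isSymmSndFDerivAt (by simp)
  rw [key, key, hsymm]

theorem contDiff_pd {f : E m → ℝ} (hf : ContDiff ℝ ∞ f) (i : Fin m) : ContDiff ℝ ∞ (pd i f) :=
  (hf.fderiv_right (m := ∞) (by simp)).clm_apply contDiff_const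

section MatrixFunctions

variable {V ι : Type*} [NormedAddCommGroup V] [NormedSpace ℝ V] [Fintype ι] [DecidableEq ι]
  {n : WithTop ℕ∞}

theorem contDiff_det {A : V → Matrix ι ι ℝ} (hA : ∀ i j, ContDiff ℝ n fun x => A x i j) :
    ContDiff ℝ n fun x => (A x).det := by
  simp only [Matrix.det_apply]
  exact ContDiff.sum fun σ _ => (contDiff_prod fun i _ => hA (σ i) i).const_smul _

theorem contDiff_adjugate {A : V → Matrix ι ι ℝ} (hA : ∀ i j, ContDiff ℝ n fun x => A x i j)
    (i j : ι) : ContDiff ℝ n fun x => (A x).adjugate i j := by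
  simp only [Matrix.adjugate_apply]
  refine contDiff_det fun a b => ?_
  obtain rfl | h := eq_or_ne a j
  · simp only [Matrix.updateRow_self, contDiff_const]
  · simpa only [Matrix.updateRow_ne h] using hA a b

end MatrixFunctions

theorem contDiff_metric_inv (g : Metric m) (i j : Fin m) :
    ContDiff ℝ ∞ fun x => (g.toMatrix x)⁻¹ i j := by
  simp only [Matrix.inv_def, Matrix.smul_apply, Ring.inverse_eq_inv', smul_eq_mul]
  exact ((contDiff_det g.smooth).inv g.nondeg).mul (contDiff_adjugate g.smooth i j)

theorem contDiff_christoffel (g : Metric m) (i j k : Fin m) :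
    ContDiff ℝ ∞ (christoffel g i j k) :=
  contDiff_const.mul (ContDiff.sum fun l _ => (contDiff_metric_inv g k l).mul
    (((contDiff_pd (g.smooth _ _) _).add (contDiff_pd (g.smooth _ _) _)).sub
      (contDiff_pd (g.smooth _ _) _)))

theorem contDiff_curvature (g : Metric m) (i j k l : Fin m) :
    ContDiff ℝ ∞ (curvature g i j k l) :=
  have hΓ := contDiff_christoffel g
  ((contDiff_pd (hΓ _ _ _) _).sub (contDiff_pd (hΓ _ _ _) _)).add
    (ContDiff.sum fun _ _ => ((hΓ _ _ _).mul (hΓ _ _ _)).sub ((hΓ _ _ _).mul (hΓ _ _ _)))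

theorem contDiff_covDeriv (g : Metric m) {n : ℕ} {T : (Fin n → Fin m) → Fin m → E m → ℝ}
    (hT : ∀ I k, ContDiff ℝ ∞ (T I k)) (J : Fin (n + 1) → Fin m) (k : Fin m) :
    ContDiff ℝ ∞ (covDeriv g T J k) :=
  have hΓ := contDiff_christoffel g
  ((contDiff_pd (hT _ _) _).sub (ContDiff.sum fun _ _ => ContDiff.sum fun _ _ =>
    (hΓ _ _ _).mul (hT _ _))).add (ContDiff.sum fun _ _ => (hΓ _ _ _).mul (hT _ _))

theorem contDiff_nablaR (g : Metric m) (ν : ℕ) (I : Fin (3 + ν) → Fin m) (k : Fin m) :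
    ContDiff ℝ ∞ (nablaR g ν I k) := by
  induction ν generalizing k with
  | zero => exact contDiff_curvature g _ _ _ _
  | succ ν ih => exact contDiff_covDeriv g ih I k

/-! ### Triangularity of the curvature -/

namespace DependsOnlyBelow

variable {k : Fin m} {f h : E m → ℝ}

theorem mono {l : Fin m} (hf : DependsOnlyBelow k f) (hkl : k ≤ l) : DependsOnlyBelow l f :=
  fun x y hxy => hf x y fun i hi => hxy i (hi.trans_le hkl)

theorem pd (hf : DependsOnlyBelow k f) (i : Fin m) : DependsOnlyBelow k (pd i f) := by
  intro x y hxy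
  have hshift : (fun z => f (z + x)) = fun z => f (z + y) :=
    funext fun z => hf _ _ fun j hj => congr(z j + $(hxy j hj))
  have hderiv := congr(fderiv ℝ $hshift 0 (basisVec i))
  simpa only [fderiv_comp_add_right, zero_add, GPW.pd] using hderiv

theorem pd_eq_zero (hf : DependsOnlyBelow k f) {i : Fin m} (hi : k ≤ i) : GPW.pd i f = 0 := by
  funext x
  by_cases hd : DifferentiableAt ℝ f x
  · have hconst : (fun t : ℝ => f (x + t • basisVec i)) = fun _ => f x := by
      refine funext fun t => hf _ _ fun j hj => ?_
      simp [basisVec, Pi.single_eq_of_ne (hj.trans_le hi).ne]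
    have hline : HasDerivAt (fun t : ℝ => f (x + t • basisVec i)) (GPW.pd i f x) 0 :=
      hd.hasFDerivAt.hasLineDerivAt (basisVec i)
    exact (hconst ▸ hline).unique (hasDerivAt_const _ _)
  · exact congr($(fderiv_zero_of_not_differentiableAt hd) (basisVec i))

end DependsOnlyBelow

/-- The behaviour of the components of a triangular tensor field, where `S` is the set of lower
indices and `k` the upper index of the component `f`: it vanishes unless `k` exceeds all lower
indices, and it depends only on the coordinates below `k`. -/
def IsTriangularAt (S : Set (Fin m)) (k : Fin m) (f : E m → ℝ) : Prop :=
  ((∃ i ∈ S, k ≤ i) → f = 0) ∧ DependsOnlyBelow k f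

namespace IsTriangularAt

variable {S S' : Set (Fin m)} {k : Fin m} {f h : E m → ℝ}

theorem anti (hf : IsTriangularAt S' k f) (hS : S ⊆ S') : IsTriangularAt S k f :=
  ⟨fun ⟨i, hi, hki⟩ => hf.1 ⟨i, hS hi, hki⟩, hf.2⟩

theorem zero : IsTriangularAt S k (0 : E m → ℝ) := ⟨fun _ => rfl, fun _ _ _ => rfl⟩

theorem add (hf : IsTriangularAt S k f) (hh : IsTriangularAt S k h) :
    IsTriangularAt S k fun x => f x + h x :=
  ⟨fun hi => funext fun x => by simp [hf.1 hi, hh.1 hi],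
    fun x y hxy => congr($(hf.2 x y hxy) + $(hh.2 x y hxy))⟩

theorem sub (hf : IsTriangularAt S k f) (hh : IsTriangularAt S k h) :
    IsTriangularAt S k fun x => f x - h x :=
  ⟨fun hi => funext fun x => by simp [hf.1 hi, hh.1 hi],
    fun x y hxy => congr($(hf.2 x y hxy) - $(hh.2 x y hxy))⟩

theorem sum {ι : Type*} [Fintype ι] {f : ι → E m → ℝ} (hf : ∀ a, IsTriangularAt S k (f a)) :
    IsTriangularAt S k fun x => ∑ a, f a x :=
  ⟨fun hi => funext fun _ => Finset.sum_eq_zero fun a _ => congrFun ((hf a).1 hi) _,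
    fun x y hxy => Finset.sum_congr rfl fun a _ => (hf a).2 x y hxy⟩

theorem pd (hf : IsTriangularAt S k f) (i : Fin m) : IsTriangularAt (insert i S) k (pd i f) := by
  refine ⟨?_, hf.2.pd i⟩
  rintro ⟨j, rfl | hj, hkj⟩
  · exact hf.2.pd_eq_zero hkj
  · exact hf.1 ⟨j, hj, hkj⟩ ▸ pd_zero i

/-- One term of a contraction: the upper index `r` of `f` is a lower index of `h`. -/
theorem contract {r : Fin m} (hf : IsTriangularAt S r f) (hh : IsTriangularAt (insert r S') k h) :
    IsTriangularAt (S ∪ S') k fun x => f x * h x := by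
  obtain hkr | hrk := le_or_gt k r
  · have h0 : h = 0 := hh.1 ⟨r, Set.mem_insert .., hkr⟩
    simpa only [h0, Pi.zero_apply, mul_zero, Pi.zero_def] using zero (S := S ∪ S') (k := k)
  · refine ⟨?_, fun x y hxy => congr($(hf.2.mono hrk.le x y hxy) * $(hh.2 x y hxy))⟩
    rintro ⟨i, hi | hi, hki⟩
    · simp [hf.1 ⟨i, hi, hrk.le.trans hki⟩, Pi.zero_def]
    · simp [hh.1 ⟨i, Set.mem_insert_of_mem r hi, hki⟩, Pi.zero_def]

end IsTriangularAt

namespace IsGeneralizedPlaneWave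

variable {g : Metric m} (hg : IsGeneralizedPlaneWave g)
include hg

theorem isTriangularAt_christoffel (i j k : Fin m) :
    IsTriangularAt {i, j} k (christoffel g i j k) := by
  refine ⟨?_, (hg i j k).2⟩
  rintro ⟨a, rfl | rfl, hka⟩ <;> exact funext ((hg _ _ k).1 (le_max_iff.2 (by tauto)))

theorem isTriangularAt_curvature (i j k l : Fin m) :
    IsTriangularAt {i, j, k} l (curvature g i j k l) := by
  have hΓ := hg.isTriangularAt_christoffel
  have hprod (a b n : Fin m) :
      IsTriangularAt {a, b, k} l fun x => christoffel g a n l x * christoffel g b k n x := by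
    simp only [mul_comm (christoffel g a n l _)]
    refine ((hΓ b k n).contract (S' := {a}) (Set.pair_comm a n ▸ hΓ a n l)).anti ?_
    grind
  have hswap : ({i, j, k} : Set (Fin m)) = {j, i, k} := Set.insert_comm ..
  exact (((hΓ j k l).pd i).sub (hswap ▸ (hΓ i k l).pd j)).add
    (.sum fun n => (hprod i j n).sub (hswap ▸ hprod j i n))

theorem isTriangularAt_covDeriv {n : ℕ} {T : (Fin n → Fin m) → Fin m → E m → ℝ}
    (hT : ∀ I k, IsTriangularAt (Set.range I) k (T I k)) (J : Fin (n + 1) → Fin m) (k : Fin m) :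
    IsTriangularAt (Set.range J) k (covDeriv g T J k) := by
  have hΓ := hg.isTriangularAt_christoffel
  set j := J (Fin.last n)
  set I : Fin n → Fin m := fun a => J a.castSucc
  have hJ : Set.range J ⊆ insert j (Set.range I) := by
    rintro _ ⟨a, rfl⟩
    induction a using Fin.lastCases <;> simp [j, I]
  have hlower (a : Fin n) (r : Fin m) : IsTriangularAt (Set.range J) k
      fun x => christoffel g j (I a) r x * T (Function.update I a r) k x := by
    refine ((hΓ j (I a) r).contract (S' := I '' {a}ᶜ) ((hT _ k).anti ?_)).anti (hJ.trans ?_)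
    · rintro _ (rfl | ⟨b, hb, rfl⟩)
      · exact ⟨a, Function.update_self ..⟩
      · exact ⟨b, Function.update_of_ne hb ..⟩
    · rintro _ (rfl | ⟨b, rfl⟩)
      · simp
      · by_cases hb : b = a
        · simp [hb]
        · exact Or.inr ⟨b, hb, rfl⟩
  have hupper (r : Fin m) : IsTriangularAt (Set.range J) k
      fun x => christoffel g j r k x * T I r x := by
    simp only [mul_comm (christoffel g j r k _)]
    refine ((hT I r).contract (S' := {j}) (Set.pair_comm j r ▸ hΓ j r k)).anti ?_
    rwa [Set.union_singleton]
  exact ((((hT I k).pd j).anti hJ).sub (.sum fun a => .sum (hlower a))).add (.sum hupper)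

theorem isTriangularAt_nablaR (ν : ℕ) (I : Fin (3 + ν) → Fin m) (k : Fin m) :
    IsTriangularAt (Set.range I) k (nablaR g ν I k) := by
  induction ν generalizing k with
  | zero =>
    refine (hg.isTriangularAt_curvature _ _ _ k).anti ?_
    rintro _ ⟨a, rfl⟩
    change Fin 3 at a
    fin_cases a <;> simp
  | succ ν ih => exact hg.isTriangularAt_covDeriv ih I k

theorem nablaR_eq_zero {ν : ℕ} {I : Fin (3 + ν) → Fin m} {k : Fin m} (h : ∃ a, k ≤ I a) (x : E m) :
    nablaR g ν I k x = 0 :=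
  congrFun ((hg.isTriangularAt_nablaR ν I k).1 (Set.exists_range_iff.2 h)) x

theorem curvature_eq_zero {i j k l : Fin m} (h : l ≤ i ∨ l ≤ j ∨ l ≤ k) (x : E m) :
    curvature g i j k l x = 0 :=
  congrFun ((hg.isTriangularAt_curvature i j k l).1 (by simpa using h)) x

theorem isNilpotentOsserman : IsNilpotentOsserman g := fun x ξ =>
  pow_eq_zero_of_strictly_lowerTriangular fun l i h => by
    simp [jacobiOp, hg.curvature_eq_zero (.inl h)]

theorem isNilpotentIvanovPetrova : IsNilpotentIvanovPetrova g := fun x e₁ e₂ _ =>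
  pow_eq_zero_of_strictly_lowerTriangular fun l k h => by
    simp [curvatureOp, hg.curvature_eq_zero (.inr (.inr h))]

theorem isNilpotentSzabo : IsNilpotentSzabo g := fun x ξ =>
  pow_eq_zero_of_strictly_lowerTriangular fun l i h => by
    have hR (j k n : Fin m) : nablaR g 1 ![i, j, k, n] l x = 0 :=
      hg.nablaR_eq_zero ⟨(0 : Fin 4), h⟩ x
    simp [szaboOp, hR]

theorem isRicciFlat : IsRicciFlat g := fun _ _ x =>
  Finset.sum_eq_zero fun _ _ => hg.curvature_eq_zero (.inl le_rfl) x

theorem isEinstein : IsEinstein g := ⟨0, fun i j x => by rw [hg.isRicciFlat, zero_mul]⟩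

end IsGeneralizedPlaneWave

/-! ### Skewness of the curvature -/

/-- Lowering of an index: the components `u_l = ∑ n, g_{ln} u^n` of the covector field dual to the
vector field with components `u^n`. -/
noncomputable def flat (g : Metric m) (u : Fin m → E m → ℝ) (l : Fin m) (x : E m) : ℝ :=
  ∑ n, g.toMatrix x l n * u n x

theorem contDiff_flat (g : Metric m) {u : Fin m → E m → ℝ} (hu : ∀ n, ContDiff ℝ ∞ (u n))
    (l : Fin m) : ContDiff ℝ ∞ (flat g u l) :=
  ContDiff.sum fun n _ => (g.smooth l n).mul (hu n)

theorem sum_mul_flat_comm (g : Metric m) (u v : Fin m → E m → ℝ) (x : E m) :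
    ∑ r, u r x * flat g v r x = ∑ r, v r x * flat g u r x := by
  simp only [flat, Finset.mul_sum]
  rw [Finset.sum_comm]
  refine Finset.sum_congr rfl fun n _ => Finset.sum_congr rfl fun r _ => ?_
  rw [(g.symm x).apply n r]
  ring

theorem flat_christoffel (g : Metric m) (i j k : Fin m) (x : E m) :
    flat g (christoffel g i j) k x =
      (1 / 2) * (pd i (fun y => g.toMatrix y j k) x + pd j (fun y => g.toMatrix y i k) x
        - pd k (fun y => g.toMatrix y i j) x) := by
  set v : Fin m → ℝ := fun l => pd i (fun y => g.toMatrix y j l) x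
    + pd j (fun y => g.toMatrix y i l) x - pd l (fun y => g.toMatrix y i j) x
  have hΓ : (fun n => christoffel g i j n x) = (1 / 2 : ℝ) • (g.toMatrix x)⁻¹.mulVec v := rfl
  calc flat g (christoffel g i j) k x
      = (g.toMatrix x).mulVec (fun n => christoffel g i j n x) k := rfl
    _ = (1 / 2) * v k := by
        rw [hΓ, Matrix.mulVec_smul, Matrix.mulVec_mulVec,
          Matrix.mul_nonsing_inv _ (g.nondeg x).isUnit, Matrix.one_mulVec, Pi.smul_apply,
          smul_eq_mul]

theorem pd_metric (g : Metric m) (i j k : Fin m) (x : E m) :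
    pd i (fun y => g.toMatrix y j k) x =
      flat g (christoffel g i j) k x + flat g (christoffel g i k) j x := by
  have hsymm (a b : Fin m) : (fun y => g.toMatrix y a b) = fun y => g.toMatrix y b a :=
    funext fun y => (g.symm y).apply b a
  rw [flat_christoffel, flat_christoffel, hsymm k j, hsymm i j, hsymm i k]
  ring

theorem flat_covDeriv_vector (g : Metric m) {u : Fin m → E m → ℝ}
    (hu : ∀ n, ContDiff ℝ ∞ (u n)) (j l : Fin m) (x : E m) :
    flat g (fun n y => pd j (u n) y + ∑ r, christoffel g j r n y * u r y) l x =
      pd j (flat g u l) x - ∑ r, christoffel g j l r x * flat g u r x := by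
  have hprod (n : Fin m) : pd j (fun y => g.toMatrix y l n * u n y) x =
      g.toMatrix x l n * pd j (u n) x
        + u n x * (flat g (christoffel g j l) n x + flat g (christoffel g j n) l x) := by
    rw [pd_mul ((g.smooth l n).differentiable (by simp) x) ((hu n).differentiable (by simp) x),
      pd_metric]
  have hΓ : ∑ n, u n x * flat g (christoffel g j n) l x =
      ∑ n, g.toMatrix x l n * ∑ r, christoffel g j r n x * u r x := by
    simp only [flat, Finset.mul_sum]
    rw [Finset.sum_comm]
    exact Finset.sum_congr rfl fun n _ => Finset.sum_congr rfl fun r _ => by ring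
  have hpd : pd j (flat g u l) x = ∑ n, pd j (fun y => g.toMatrix y l n * u n y) x :=
    pd_sum _ (fun n _ => ((g.smooth l n).mul (hu n)).differentiable (by simp) x) j
  rw [hpd, sum_mul_flat_comm g (christoffel g j l) u]
  simp only [hprod, mul_add, Finset.sum_add_distrib, hΓ]
  simp only [flat, mul_add, Finset.sum_add_distrib]
  ring

theorem flat_curvature (g : Metric m) (i j k l : Fin m) (x : E m) :
    flat g (curvature g i j k) l x =
      pd i (flat g (christoffel g j k) l) x - pd j (flat g (christoffel g i k) l) x
        - ∑ r, christoffel g i l r x * flat g (christoffel g j k) r x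
        + ∑ r, christoffel g j l r x * flat g (christoffel g i k) r x := by
  have hΓ (a b c : Fin m) := flat_covDeriv_vector g (contDiff_christoffel g b c) a l x
  calc flat g (curvature g i j k) l x
      = flat g (fun n y => pd i (christoffel g j k n) y
            + ∑ r, christoffel g i r n y * christoffel g j k r y) l x
          - flat g (fun n y => pd j (christoffel g i k n) y
            + ∑ r, christoffel g j r n y * christoffel g i k r y) l x := by
        simp only [flat, curvature, ← Finset.sum_sub_distrib]
        refine Finset.sum_congr rfl fun n _ => ?_
        rw [Finset.sum_sub_distrib]
        ring
    _ = _ := by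
        rw [hΓ, hΓ]
        ring

theorem flat_curvature_skew (g : Metric m) (i j k l : Fin m) (x : E m) :
    flat g (curvature g i j l) k x = -flat g (curvature g i j k) l x := by
  have hdiff (a b c : Fin m) : DifferentiableAt ℝ (flat g (christoffel g a b) c) x :=
    (contDiff_flat g (contDiff_christoffel g a b) c).differentiable (by simp) x
  have hpd (a b : Fin m) : pd a (flat g (christoffel g b k) l) x
      + pd a (flat g (christoffel g b l) k) x = pd a (pd b fun y => g.toMatrix y k l) x := by
    rw [← pd_add (hdiff ..) (hdiff ..), funext (pd_metric g b k l)]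
  have hcomm := congrFun (pd_comm (mod_cast contDiff_infty.1 (g.smooth k l) 2) i j) x
  rw [flat_curvature, flat_curvature, sum_mul_flat_comm g (christoffel g i k),
    sum_mul_flat_comm g (christoffel g j k)]
  linear_combination hpd i j - hpd j i + hcomm

section Lower

variable {α : Type*} [Fintype α] [DecidableEq α]

/-- The covariant derivative, in the direction `∂_j`, of a purely covariant tensor field with an
arbitrary finite type `α` of slots. -/
noncomputable def covDerivLower (g : Metric m) (L : (α → Fin m) → E m → ℝ) (j : Fin m)
    (I : α → Fin m) (x : E m) : ℝ :=
  pd j (L I) x - ∑ a, ∑ r, christoffel g j (I a) r x * L (Function.update I a r) x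

theorem covDerivLower_comp_perm (g : Metric m) (L : (α → Fin m) → E m → ℝ) (j : Fin m)
    (I : α → Fin m) (π : Equiv.Perm α) (x : E m) :
    covDerivLower g L j (I ∘ π) x = covDerivLower g (fun K => L (K ∘ π)) j I x := by
  refine congrArg (_ - ·) ?_
  rw [← Equiv.sum_comp π.symm]
  refine Finset.sum_congr rfl fun a _ => Finset.sum_congr rfl fun r _ => ?_
  rw [← Function.update_comp_equiv, Function.comp_apply, π.apply_symm_apply]

theorem covDerivLower_neg (g : Metric m) (L : (α → Fin m) → E m → ℝ) (j : Fin m)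
    (I : α → Fin m) (x : E m) :
    covDerivLower g (fun K y => -L K y) j I x = -covDerivLower g L j I x := by
  have hpd : pd j (fun y => -L I y) x = -pd j (L I) x := congr($(fderiv_fun_neg) (basisVec j))
  simp only [covDerivLower, hpd, mul_neg, Finset.sum_neg_distrib]
  ring

end Lower

section Skew

variable {n : ℕ}

/-- The purely covariant tensor field obtained from `T` by lowering its upper index. The slot
`none` is the lowered one. -/
noncomputable def lower (g : Metric m) (T : (Fin n → Fin m) → Fin m → E m → ℝ)
    (J : Option (Fin n) → Fin m) (x : E m) : ℝ :=
  flat g (T (J ∘ some)) (J none) x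

theorem lower_covDeriv (g : Metric m) {T : (Fin n → Fin m) → Fin m → E m → ℝ}
    (hT : ∀ I k, ContDiff ℝ ∞ (T I k)) (J : Option (Fin (n + 1)) → Fin m) (x : E m) :
    lower g (covDeriv g T) J x =
      covDerivLower g (lower g T) (J (some (Fin.last n))) (J ∘ Option.map Fin.castSucc) x := by
  set j := J (some (Fin.last n))
  set I : Fin n → Fin m := fun a => J (some a.castSucc)
  have hsome (a : Fin n) (r : Fin m) :
      lower g T (Function.update (J ∘ Option.map Fin.castSucc) (some a) r) x =
        flat g (T (Function.update I a r)) (J none) x := by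
    rw [lower, Function.update_comp_eq_of_injective _ (Option.some_injective _),
      Function.update_of_ne (by simp)]
    rfl
  have hnone (r : Fin m) :
      lower g T (Function.update (J ∘ Option.map Fin.castSucc) none r) x = flat g (T I) r x := by
    rw [lower, Function.update_comp_eq_of_notMem_range _ _ (by simp), Function.update_self]
    rfl
  have hflat : flat g (fun k y => ∑ a, ∑ r, christoffel g j (I a) r y
        * T (Function.update I a r) k y) (J none) x =
      ∑ a, ∑ r, christoffel g j (I a) r x * flat g (T (Function.update I a r)) (J none) x := by
    simp only [flat, Finset.mul_sum]
    rw [Finset.sum_comm]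
    refine Finset.sum_congr rfl fun a _ => ?_
    rw [Finset.sum_comm]
    exact Finset.sum_congr rfl fun r _ => Finset.sum_congr rfl fun k _ => by ring
  calc lower g (covDeriv g T) J x
      = flat g (fun k y => pd j (T I k) y + ∑ r, christoffel g j r k y * T I r y) (J none) x
          - ∑ a, ∑ r, christoffel g j (I a) r x
              * flat g (T (Function.update I a r)) (J none) x := by
        rw [← hflat, lower, flat, flat, flat, ← Finset.sum_sub_distrib]
        refine Finset.sum_congr rfl fun k _ => ?_
        simp only [covDeriv, Function.comp_apply]
        ring
    _ = _ := by
        rw [flat_covDeriv_vector g (hT I), covDerivLower, Fintype.sum_option]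
        simp only [hsome, hnone]
        exact (sub_sub _ _ _)

/-- `T` is skew, with respect to the metric, in its lower index `c` and its upper index. -/
def IsSkewAt (g : Metric m) (c : Fin n) (T : (Fin n → Fin m) → Fin m → E m → ℝ) : Prop :=
  ∀ J x, lower g T (J ∘ Equiv.swap none (some c)) x = -lower g T J x

theorem IsSkewAt.covDeriv {g : Metric m} {c : Fin n} {T : (Fin n → Fin m) → Fin m → E m → ℝ}
    (hskew : IsSkewAt g c T) (hT : ∀ I k, ContDiff ℝ ∞ (T I k)) :
    IsSkewAt g c.castSucc (covDeriv g T) := by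
  intro J x
  have hlast : Equiv.swap none (some c.castSucc) (some (Fin.last n)) = some (Fin.last n) :=
    Equiv.swap_apply_of_ne_of_ne (by simp) (by simp [c.castSucc_lt_last.ne'])
  have hswap : (J ∘ Equiv.swap none (some c.castSucc)) ∘ Option.map Fin.castSucc =
      (J ∘ Option.map Fin.castSucc) ∘ Equiv.swap none (some c) := by
    refine funext fun a => congrArg J ?_
    exact ((Option.map_injective (Fin.castSucc_injective n)).map_swap none (some c) a).symm
  have hT_skew : (fun K => lower g T (K ∘ Equiv.swap none (some c))) =
      fun K y => -lower g T K y := funext fun K => funext (hskew K)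
  rw [lower_covDeriv g hT, lower_covDeriv g hT, hswap, Function.comp_apply, hlast,
    covDerivLower_comp_perm, hT_skew, covDerivLower_neg]

theorem isSkewAt_nablaR (g : Metric m) (ν : ℕ) :
    IsSkewAt g (Fin.castAdd ν (2 : Fin 3)) (nablaR g ν) := by
  induction ν with
  | zero => exact fun J x => flat_curvature_skew g _ _ _ _ x
  | succ ν ih => exact ih.covDeriv (contDiff_nablaR g ν)

end Skew

/-! ### A normal form of symmetric matrices under unitriangular congruence -/

section Bruhat

variable {K ι : Type*} [Field K] [LinearOrder ι]

/-- `t` is the last index at which `v` does not vanish. -/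
def IsLastNonzero {K ι : Type*} [Zero K] [LT ι] (v : ι → K) (t : ι) : Prop :=
  v t ≠ 0 ∧ ∀ j, t < j → v j = 0

theorem exists_isLastNonzero [Finite ι] {v : ι → K} (hv : v ≠ 0) : ∃ t, IsLastNonzero v t := by
  obtain ⟨t, ht, hmax⟩ := Set.Finite.exists_maximal (Set.toFinite {j | v j ≠ 0})
    (Function.ne_iff.1 hv)
  exact ⟨t, ht, fun j hj => by_contra fun h => (hmax h hj.le).not_gt hj⟩

/-- `a` is a possible `i`-th row of an upper triangular matrix with unit diagonal. -/
def IsUnitriangularRow {K ι : Type*} [Zero K] [One K] [LT ι] (i : ι) (a : ι → K) : Prop :=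
  (∀ j, j < i → a j = 0) ∧ a i = 1

theorem IsUnitriangularRow.sub_smul {i i' : ι} {a a' : ι → K} (ha : IsUnitriangularRow i a)
    (ha' : IsUnitriangularRow i' a') (h : i < i') (c : K) : IsUnitriangularRow i (a - c • a') :=
  ⟨fun j hj => by simp [ha.1 j hj, ha'.1 j (hj.trans h)], by simp [ha.2, ha'.1 i h]⟩

theorem involutive_of_forall_le [Finite ι] {σ : Equiv.Perm ι} (hσ : ∀ i, i ≤ σ (σ i)) :
    Function.Involutive σ := by
  intro i
  induction i using WellFoundedGT.induction with
  | ind i ih =>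
    by_contra hne
    have hfix := ih _ ((hσ i).lt_of_ne' hne)
    exact hne (σ.injective (σ.injective hfix))

variable [Fintype ι]

theorem IsUnitriangularRow.exists_isLastNonzero_vecMul {H : Matrix ι ι K} (hH : H.det ≠ 0) {i : ι}
    {a : ι → K} (ha : IsUnitriangularRow i a) : ∃ t, IsLastNonzero (a ᵥ* H) t := by
  refine exists_isLastNonzero fun h0 => one_ne_zero (α := K) ?_
  rw [← ha.2, Matrix.eq_zero_of_vecMul_eq_zero hH h0, Pi.zero_apply]

theorem exists_unitriangularRow_minimal {H : Matrix ι ι K} (hH : H.det ≠ 0) (i : ι) :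
    ∃ a t, IsUnitriangularRow i a ∧ IsLastNonzero (a ᵥ* H) t ∧
      ∀ b s, IsUnitriangularRow i b → IsLastNonzero (b ᵥ* H) s → t ≤ s := by
  have hone : IsUnitriangularRow i (Pi.single i (1 : K)) :=
    ⟨fun j hj => Pi.single_eq_of_ne hj.ne _, Pi.single_eq_same ..⟩
  obtain ⟨t, ⟨a, ha, hat⟩, hmin⟩ := Set.Finite.exists_minimal
    (Set.toFinite {s | ∃ b, IsUnitriangularRow i b ∧ IsLastNonzero (b ᵥ* H) s})
    ((hone.exists_isLastNonzero_vecMul hH).imp fun s hs => ⟨_, hone, hs⟩)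
  exact ⟨a, t, ha, hat, fun b s hb hs => (le_total t s).elim id (hmin ⟨b, hb, hs⟩)⟩

/-- Part of the Bruhat decomposition. -/
theorem exists_unitriangular_mul_eq_zero {H : Matrix ι ι K} (hH : H.det ≠ 0) :
    ∃ (A : Matrix ι ι K) (σ : Equiv.Perm ι), A.IsUpperTriangular ∧ (∀ i, A i i = 1) ∧
      ∀ i j, σ i < j → (A * H) i j = 0 := by
  choose A σ hA hσ hmin using exists_unitriangularRow_minimal hH
  have hne (i i' : ι) (h : i < i') : σ i ≠ σ i' := by
    intro hσi
    have hrow := (hA i).sub_smul (hA i') h ((A i ᵥ* H) (σ i) / (A i' ᵥ* H) (σ i'))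
    set b := A i - ((A i ᵥ* H) (σ i) / (A i' ᵥ* H) (σ i')) • A i'
    have hb (j : ι) (hj : σ i ≤ j) : (b ᵥ* H) j = 0 := by
      rw [Matrix.sub_vecMul, Matrix.smul_vecMul, Pi.sub_apply, Pi.smul_apply, smul_eq_mul]
      obtain rfl | hj := hj.eq_or_lt
      · rw [hσi, div_mul_cancel₀ _ (hσ i').1, sub_self]
      · rw [(hσ i).2 j hj, (hσ i').2 j (hσi ▸ hj), mul_zero, sub_zero]
    obtain ⟨s, hs⟩ := hrow.exists_isLastNonzero_vecMul hH
    exact hs.1 (hb s (hmin i b s hrow hs))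
  have hinj : Function.Injective σ := fun i i' h => by
    by_contra hii
    exact (lt_or_gt_of_ne hii).elim (hne i i' · h) (hne i' i · h.symm)
  exact ⟨A, .ofBijective σ (Finite.injective_iff_bijective.1 hinj), fun i j h => (hA i).1 j h,
    fun i => (hA i).2, fun i j h => (hσ i).2 j h⟩

theorem exists_unitriangular_conj_eq_zero {H : Matrix ι ι K} (hH : H.det ≠ 0) (hsymm : H.IsSymm) :
    ∃ (A : Matrix ι ι K) (σ : Equiv.Perm ι), A.IsUpperTriangular ∧ (∀ i, A i i = 1) ∧
      Function.Involutive σ ∧ ∀ i j, σ i < j → (A * H * A.transpose) i j = 0 := by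
  obtain ⟨A, σ, hA, hdiag, hAH⟩ := exists_unitriangular_mul_eq_zero hH
  have hzero (i j : ι) (hij : σ i < j) : (A * H * A.transpose) i j = 0 := by
    refine (Matrix.mul_apply ..).trans (Finset.sum_eq_zero fun k _ => ?_)
    obtain hk | hk := lt_or_ge (σ i) k
    · rw [hAH i k hk, zero_mul]
    · rw [Matrix.transpose_apply, hA (hk.trans_lt hij), mul_zero]
  refine ⟨A, σ, hA, hdiag, involutive_of_forall_le fun i => ?_, hzero⟩
  set H' := A * H * A.transpose
  have hdetA : A.det = 1 := by
    simp only [Matrix.det_of_isUpperTriangular hA, hdiag, Finset.prod_const_one]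
  have hdet : (H'.submatrix σ.symm id).det ≠ 0 := by
    rw [Matrix.det_permute, Matrix.det_mul, Matrix.det_mul, Matrix.det_transpose, hdetA]
    rcases Int.units_eq_one_or (Equiv.Perm.sign σ.symm) with h | h <;> simpa [h] using hH
  have hpivot : H' i (σ i) ≠ 0 := by
    rw [Matrix.det_of_isLowerTriangular (H'.submatrix σ.symm id) fun _ j hij =>
      hzero _ j (by simpa using hij)] at hdet
    simpa using Finset.prod_ne_zero_iff.1 hdet (σ i) (Finset.mem_univ _)
  have hsymm' : H'.IsSymm := by
    simp [H', Matrix.IsSymm, Matrix.transpose_mul, hsymm.eq, Matrix.mul_assoc]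
  by_contra! hlt
  exact hpivot (hsymm'.apply (σ i) i ▸ hzero (σ i) i hlt)

end Bruhat

/-! ### Frame changes and complete contractions -/

section FrameChange

variable {R ι α : Type*} [CommRing R] [Fintype ι] [Fintype α] [DecidableEq α]

/-- The components, in a new frame, of the tensor whose components in the old frame are `T`; the
frame change acts on the index slot `a` through the matrix `M a`. -/
def changeFrame (M : α → Matrix ι ι R) (T : (α → ι) → R) (I : α → ι) : R :=
  ∑ J, (∏ a, M a (I a) (J a)) * T J

theorem exists_of_changeFrame_ne_zero {M : α → Matrix ι ι R} {T : (α → ι) → R} {I : α → ι}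
    (h : changeFrame M T I ≠ 0) : ∃ J, (∀ a, M a (I a) (J a) ≠ 0) ∧ T J ≠ 0 := by
  obtain ⟨J, -, hJ⟩ := Finset.exists_ne_zero_of_sum_ne_zero h
  exact ⟨J, fun a ha => left_ne_zero_of_mul hJ (Finset.prod_eq_zero (Finset.mem_univ a) ha),
    right_ne_zero_of_mul hJ⟩

theorem changeFrame_neg (M : α → Matrix ι ι R) (T : (α → ι) → R) (I : α → ι) :
    changeFrame M (fun J => -T J) I = -changeFrame M T I := by
  simp only [changeFrame, mul_neg, Finset.sum_neg_distrib]

theorem changeFrame_comp_perm (C : Matrix ι ι R) (T : (α → ι) → R) (I : α → ι)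
    (π : Equiv.Perm α) :
    changeFrame (fun _ => C) T (I ∘ π) = changeFrame (fun _ => C) (fun K => T (K ∘ π)) I := by
  refine Fintype.sum_equiv (π.arrowCongr (Equiv.refl ι)) _ _ fun J => ?_
  have hJ : (π.arrowCongr (Equiv.refl ι) J) ∘ π = J := funext fun a => by simp
  refine congrArg₂ (· * ·) (Fintype.prod_equiv π _ _ fun a => ?_) (congrArg T hJ.symm)
  simp

/-- The tensor `T` as a function of the indices in all its slots, among which the last one carries
the label `none`. -/
def uncurryOption {β : Type*} (T : (β → ι) → ι → R) (J : Option β → ι) : R := T (J ∘ some) (J none)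

theorem changeFrame_option (M : Option α → Matrix ι ι R) (T : (α → ι) → ι → R)
    (I : Option α → ι) :
    changeFrame M (uncurryOption T) I =
      ∑ r, M none (I none) r * changeFrame (M ∘ some) (fun K => T K r) (I ∘ some) := by
  simp only [changeFrame, uncurryOption, Finset.mul_sum]
  rw [← Fintype.sum_prod_type',
    ← (Equiv.piOptionEquivProd (β := fun _ : Option α => ι)).symm.sum_comp]
  exact Fintype.sum_congr _ _ fun p => by
    simp [Fintype.prod_option, mul_assoc, Equiv.piOptionEquivProd, Function.comp_def]

theorem changeFrame_fin_two (C G : Matrix ι ι R) (I : Fin 2 → ι) :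
    changeFrame (fun _ => C) (fun J => G (J 0) (J 1)) I = (C * G * C.transpose) (I 0) (I 1) := by
  rw [changeFrame, ← (finTwoArrowEquiv ι).symm.sum_comp, Fintype.sum_prod_type_right]
  simp only [Matrix.mul_apply, Finset.sum_mul]
  exact Fintype.sum_congr _ _ fun i => Fintype.sum_congr _ _ fun j => by
    simp [Fin.prod_univ_two]; ring

theorem changeFrame_sigma {Φ : Type*} [Fintype Φ] [DecidableEq Φ] {β : Φ → Type*}
    [∀ φ, Fintype (β φ)] [∀ φ, DecidableEq (β φ)] (M : (Σ φ, β φ) → Matrix ι ι R)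
    (T : ∀ φ, (β φ → ι) → R) (I : (Σ φ, β φ) → ι) :
    changeFrame M (fun J => ∏ φ, T φ fun a => J ⟨φ, a⟩) I =
      ∏ φ, changeFrame (fun a => M ⟨φ, a⟩) (T φ) fun a => I ⟨φ, a⟩ := by
  simp only [changeFrame]
  rw [Finset.prod_univ_sum, Fintype.piFinset_univ, ← (Equiv.piCurry fun φ (_ : β φ) => ι).sum_comp]
  exact Fintype.sum_congr _ _ fun J => by
    rw [Fintype.prod_sigma, ← Finset.prod_mul_distrib]
    rfl

variable {γ U : Type*} [Fintype γ] [DecidableEq γ] [Fintype U] [DecidableEq U]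

/-- The complete contraction of a tensor. The bijection `e` pairs the lower slots `e.symm (inl u)`
with the upper slots `e.symm (inr u)`. -/
def contraction (e : γ ≃ U ⊕ U) (t : (γ → ι) → R) : R := ∑ f : U → ι, t (Sum.elim f f ∘ e)

variable [DecidableEq ι]

/-- The action of the frame change `∂_i ↦ ∑ j, A i j ∂_j` on a lower (`true`) or an upper (`false`)
index. -/
noncomputable def frameMatrix (A : Matrix ι ι R) (isLower : Bool) : Matrix ι ι R :=
  bif isLower then A else A⁻¹.transpose

theorem sum_frameMatrix_mul {A : Matrix ι ι R} (hA : IsUnit A.det) (p q : ι) :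
    ∑ i, frameMatrix A true i p * frameMatrix A false i q = if p = q then 1 else 0 := by
  calc ∑ i, frameMatrix A true i p * frameMatrix A false i q
      = (A⁻¹ * A) q p := by
        rw [Matrix.mul_apply]
        exact Fintype.sum_congr _ _ fun i => mul_comm _ _
    _ = _ := by rw [Matrix.nonsing_inv_mul A hA, Matrix.one_apply]; simp only [eq_comm]

theorem contraction_changeFrame {A : Matrix ι ι R} (hA : IsUnit A.det) (e : γ ≃ U ⊕ U)
    (t : (γ → ι) → R) :
    contraction e (changeFrame (fun c => frameMatrix A (e c).isLeft) t) = contraction e t := by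
  let F (p q f : U → ι) (c : U ⊕ U) : R :=
    frameMatrix A c.isLeft (Sum.elim f f c) (Sum.elim p q c)
  have hpair (p q : U → ι) : ∑ f, ∏ c, F p q f (e c) = if p = q then 1 else 0 := by
    have hsplit (f : U → ι) : ∏ c, F p q f (e c) =
        ∏ u, frameMatrix A true (f u) (p u) * frameMatrix A false (f u) (q u) := by
      rw [e.prod_comp (F p q f), Fintype.prod_sum_type, ← Finset.prod_mul_distrib]
      rfl
    rw [Fintype.sum_congr _ _ hsplit, ← Fintype.piFinset_univ, ← Finset.prod_univ_sum _
      fun u i => frameMatrix A true i (p u) * frameMatrix A false i (q u)]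
    simp only [sum_frameMatrix_mul hA, Fintype.prod_ite_zero, Finset.prod_const_one, funext_iff]
  let E := (e.arrowCongr (Equiv.refl ι)).trans (Equiv.sumArrowEquivProdArrow U U ι)
  calc contraction e (changeFrame (fun c => frameMatrix A (e c).isLeft) t)
      = ∑ J, (∑ f : U → ι, ∏ c, frameMatrix A (e c).isLeft (Sum.elim f f (e c)) (J c)) * t J := by
        simp only [contraction, changeFrame, Finset.sum_mul]
        exact Finset.sum_comm
    _ = ∑ p : U → ι, ∑ q : U → ι, (if p = q then 1 else 0) * t (Sum.elim p q ∘ e) := by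
        rw [← E.symm.sum_comp, Fintype.sum_prod_type]
        exact Fintype.sum_congr _ _ fun p => Fintype.sum_congr _ _ fun q =>
          congrArg (· * _) (hpair p q)
    _ = contraction e t := by
        simp only [ite_mul, one_mul, zero_mul, Fintype.sum_ite_eq]
        rfl

theorem changeFrame_lower {A G : Matrix ι ι R} (hA : IsUnit A.det) (T : (α → ι) → ι → R)
    (J : Option α → ι) :
    changeFrame (fun _ => frameMatrix A true) (uncurryOption fun I => G *ᵥ T I) J =
      ((A * G * Aᵀ) *ᵥ fun k => changeFrame (fun o => frameMatrix A o.isSome)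
        (uncurryOption T) fun o => o.elim k (J ∘ some)) (J none) := by
  set S : ι → R := fun r => changeFrame (fun _ => frameMatrix A true) (T · r) (J ∘ some)
  have hupper (k : ι) : changeFrame (fun o => frameMatrix A o.isSome)
      (uncurryOption T) (fun o => o.elim k (J ∘ some)) = (A⁻¹ᵀ *ᵥ S) k :=
    changeFrame_option _ T _
  have hlower (r : ι) : changeFrame (fun _ => frameMatrix A true) (fun I => (G *ᵥ T I) r)
      (J ∘ some) = (G *ᵥ S) r := by
    simp only [changeFrame, Matrix.mulVec, dotProduct, S, Finset.mul_sum]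
    rw [Finset.sum_comm]
    exact Fintype.sum_congr _ _ fun n => Fintype.sum_congr _ _ fun I => mul_left_comm _ _ _
  have hAA : Aᵀ * A⁻¹ᵀ = 1 := by
    rw [← Matrix.transpose_mul, Matrix.nonsing_inv_mul A hA, Matrix.transpose_one]
  calc changeFrame (fun _ => frameMatrix A true) (uncurryOption fun I => G *ᵥ T I) J
      = (A *ᵥ G *ᵥ S) (J none) := by
        rw [changeFrame_option (fun _ => frameMatrix A true) fun I r => (G *ᵥ T I) r]
        exact Fintype.sum_congr _ _ fun r => congrArg (_ * ·) (hlower r)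
    _ = ((A * G * Aᵀ) *ᵥ A⁻¹ᵀ *ᵥ S) (J none) := by
        rw [Matrix.mulVec_mulVec, Matrix.mulVec_mulVec, Matrix.mul_assoc, hAA, Matrix.mul_one]
    _ = _ := by rw [funext hupper]

end FrameChange

section BoostWeight

variable {R ι α : Type*} [Fintype α]

/-- The boost weight of the component of a tensor with index `I`, for the weights `w` of the frame
vectors. Lower slots are those with `isLower a`. -/
def boostWeight (w : ι → ℤ) (isLower : α → Bool) (I : α → ι) : ℤ :=
  ∑ a, bif isLower a then w (I a) else -w (I a)

theorem contraction_eq_zero [CommRing R] [Fintype ι] {U : Type*} [Fintype U] [DecidableEq U]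
    {e : α ≃ U ⊕ U} {t : (α → ι) → R} {w : ι → ℤ}
    (ht : ∀ I, t I ≠ 0 → 0 < boostWeight w (fun a => (e a).isLeft) I) : contraction e t = 0 := by
  refine Fintype.sum_eq_zero _ fun f => by_contra fun hf => (ht _ hf).ne' ?_
  calc boostWeight w (fun a => (e a).isLeft) (Sum.elim f f ∘ e)
      = ∑ c, bif c.isLeft then w (Sum.elim f f c) else -w (Sum.elim f f c) :=
        e.sum_comp fun c => bif c.isLeft then w (Sum.elim f f c) else -w (Sum.elim f f c)
    _ = 0 := by simp

end BoostWeight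

/-! ### Frames adapted to a symmetric form -/

theorem exists_of_mulVec_ne_zero {R ι : Type*} [Semiring R] [Fintype ι] {M : Matrix ι ι R}
    {v : ι → R} {i : ι} (h : (M *ᵥ v) i ≠ 0) : ∃ j, M i j ≠ 0 ∧ v j ≠ 0 := by
  obtain ⟨j, -, hj⟩ := Finset.exists_ne_zero_of_sum_ne_zero h
  exact ⟨j, left_ne_zero_of_mul hj, right_ne_zero_of_mul hj⟩

section BruhatFrame

variable {K ι : Type*} [Field K] [Fintype ι] [LinearOrder ι]

/-- The unitriangular frame change `A` brings the non-degenerate symmetric form `G` to the normal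
form in which the pairing of the frame vectors `i` and `j` vanishes for `σ i < j`. -/
structure IsBruhatFrame (G A : Matrix ι ι K) (σ : Equiv.Perm ι) : Prop where
  isSymm : G.IsSymm
  det_ne_zero : G.det ≠ 0
  isUpperTriangular : A.IsUpperTriangular
  diag_eq_one : ∀ i, A i i = 1
  involutive : Function.Involutive σ
  conj_eq_zero : ∀ i j, σ i < j → (A * G * Aᵀ) i j = 0

theorem exists_isBruhatFrame {G : Matrix ι ι K} (hsymm : G.IsSymm) (hdet : G.det ≠ 0) :
    ∃ A σ, IsBruhatFrame G A σ := by
  obtain ⟨A, σ, hA, hdiag, hσ, hzero⟩ := exists_unitriangular_conj_eq_zero hdet hsymm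
  exact ⟨A, σ, hsymm, hdet, hA, hdiag, hσ, hzero⟩

namespace IsBruhatFrame

variable {G A : Matrix ι ι K} {σ : Equiv.Perm ι} (h : IsBruhatFrame G A σ)

include h

theorem det_eq_one : A.det = 1 := by
  simp only [Matrix.det_of_isUpperTriangular h.isUpperTriangular, h.diag_eq_one,
    Finset.prod_const_one]

theorem isUnit_det : IsUnit A.det := h.det_eq_one ▸ isUnit_one

theorem isUnit_det_conj : IsUnit (A * G * Aᵀ).det := by
  rw [Matrix.det_mul, Matrix.det_mul, Matrix.det_transpose, h.det_eq_one, one_mul, mul_one]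
  exact h.det_ne_zero.isUnit

theorem isSymm_conj : (A * G * Aᵀ).IsSymm := by
  simp [Matrix.IsSymm, Matrix.transpose_mul, h.isSymm.eq, Matrix.mul_assoc]

theorem le_of_conj_ne_zero {i j : ι} (hij : (A * G * Aᵀ) i j ≠ 0) : j ≤ σ i ∧ i ≤ σ j := by
  refine ⟨not_lt.1 (mt (h.conj_eq_zero i j) hij), not_lt.1 (mt (h.conj_eq_zero j i) ?_)⟩
  rwa [h.isSymm_conj.apply]

theorem le_of_conj_inv_ne_zero {i j : ι} (hij : (A * G * Aᵀ)⁻¹ i j ≠ 0) : σ j ≤ i ∧ σ i ≤ j := by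
  set H := A * G * Aᵀ
  let P := H.submatrix id σ
  have hP : P.BlockTriangular (OrderDual.toDual ∘ σ) := fun i j hij => h.conj_eq_zero i (σ j) hij
  let _ : Invertible H := H.invertibleOfIsUnitDet h.isUnit_det_conj
  let _ : Invertible P := Matrix.submatrixEquivInvertible H (Equiv.refl ι) σ
  have hP_inv : P⁻¹ = H⁻¹.submatrix σ id := Matrix.inv_submatrix_equiv H (Equiv.refl ι) σ
  have hzero {i j : ι} (hlt : i < σ j) : H⁻¹ i j = 0 := by
    have := Matrix.blockTriangular_inv_of_blockTriangular hP (i := σ i) (j := j)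
      (by simpa [h.involutive i] using hlt)
    rwa [hP_inv, Matrix.submatrix_apply, h.involutive i] at this
  refine ⟨not_lt.1 (mt hzero hij), not_lt.1 (mt hzero ?_)⟩
  rwa [h.isSymm_conj.inv.apply]

theorem le_of_frameMatrix_true_ne_zero {i j : ι} (hij : frameMatrix A true i j ≠ 0) : i ≤ j :=
  not_lt.1 fun hlt => hij (h.isUpperTriangular hlt)

theorem le_of_frameMatrix_false_ne_zero {i j : ι} (hij : frameMatrix A false i j ≠ 0) : j ≤ i := by
  let _ : Invertible A := A.invertibleOfIsUnitDet h.isUnit_det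
  exact not_lt.1 fun hlt =>
    hij (Matrix.blockTriangular_inv_of_blockTriangular h.isUpperTriangular hlt)

end IsBruhatFrame

end BruhatFrame

/-! ### Boost weights of a triangular tensor with a skew-symmetry -/

theorem sum_pow_lt_sum_pow {β : Type*} [Fintype β] [Nonempty β] {N : ℕ} (hN : Fintype.card β < N)
    {p q : β → ℕ} (hpq : ∀ a, ∃ b, p a < q b) : ∑ a, N ^ p a < ∑ a, N ^ q a := by
  obtain ⟨b, hb⟩ := Finite.exists_max q
  have hp (a : β) : p a ≤ q b - 1 := (hpq a).elim fun c hc => Nat.le_pred_of_lt (hc.trans_le (hb c))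
  have hqb : 0 < q b := (hpq b).elim fun c hc => hc.bot_lt.trans_le (hb c)
  have hN0 : 0 < N := hN.bot_lt
  calc ∑ a, N ^ p a
      ≤ ∑ _ : β, N ^ (q b - 1) := Finset.sum_le_sum fun a _ => Nat.pow_le_pow_right hN0 (hp a)
    _ = Fintype.card β * N ^ (q b - 1) := by rw [Finset.sum_const, smul_eq_mul, Finset.card_univ]
    _ < N * N ^ (q b - 1) := Nat.mul_lt_mul_of_pos_right hN (Nat.pow_pos hN0)
    _ = N ^ q b := mul_pow_sub_one hqb.ne' N
    _ ≤ ∑ a, N ^ q a :=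
        Finset.single_le_sum (f := fun a => N ^ q a) (fun _ _ => Nat.zero_le _) (Finset.mem_univ b)

/-- Weights of the frame vectors of a Bruhat frame. They change sign under the involution `σ`, and
powers of a large `N` make the largest index decide the sign of a sum of weights. -/
def bruhatWeight {m : ℕ} (N : ℕ) (σ : Equiv.Perm (Fin m)) (i : Fin m) : ℤ :=
  (N : ℤ) ^ (σ i : ℕ) - (N : ℤ) ^ (i : ℕ)

namespace IsBruhatFrame

variable {K α : Type*} [Field K] {m N : ℕ} {G A : Matrix (Fin m) (Fin m) K}
  {σ : Equiv.Perm (Fin m)} (h : IsBruhatFrame G A σ)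

include h

theorem bruhatWeight_add_nonneg (hN : 0 < N) {i j : Fin m} (hij : (A * G * Aᵀ) i j ≠ 0) :
    0 ≤ bruhatWeight N σ i + bruhatWeight N σ j := by
  obtain ⟨hj, hi⟩ := h.le_of_conj_ne_zero hij
  have hj' : (N : ℤ) ^ (j : ℕ) ≤ (N : ℤ) ^ (σ i : ℕ) := mod_cast Nat.pow_le_pow_right hN hj
  have hi' : (N : ℤ) ^ (i : ℕ) ≤ (N : ℤ) ^ (σ j : ℕ) := mod_cast Nat.pow_le_pow_right hN hi
  simp only [bruhatWeight]
  linarith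

theorem bruhatWeight_add_nonpos (hN : 0 < N) {i j : Fin m} (hij : (A * G * Aᵀ)⁻¹ i j ≠ 0) :
    bruhatWeight N σ i + bruhatWeight N σ j ≤ 0 := by
  obtain ⟨hj, hi⟩ := h.le_of_conj_inv_ne_zero hij
  have hj' : (N : ℤ) ^ (σ j : ℕ) ≤ (N : ℤ) ^ (i : ℕ) := mod_cast Nat.pow_le_pow_right hN hj
  have hi' : (N : ℤ) ^ (σ i : ℕ) ≤ (N : ℤ) ^ (j : ℕ) := mod_cast Nat.pow_le_pow_right hN hi
  simp only [bruhatWeight]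
  linarith

variable [Fintype α] [DecidableEq α] {T : (α → Fin m) → Fin m → K}

theorem lt_of_changeFrame_ne_zero (hT : ∀ I k, T I k ≠ 0 → ∀ a, I a < k) {I : Option α → Fin m}
    (hI : changeFrame (fun o => frameMatrix A o.isSome) (uncurryOption T) I ≠ 0)
    (a : α) : I (some a) < I none := by
  obtain ⟨J, hJ, hTJ⟩ := exists_of_changeFrame_ne_zero hI
  calc I (some a) ≤ J (some a) := h.le_of_frameMatrix_true_ne_zero (hJ (some a))
    _ < J none := hT _ _ hTJ a
    _ ≤ I none := h.le_of_frameMatrix_false_ne_zero (hJ none)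

theorem lt_of_changeFrame_lower_ne_zero (hT : ∀ I k, T I k ≠ 0 → ∀ a, I a < k)
    {J : Option α → Fin m} (hJ : changeFrame (fun _ => frameMatrix A true)
      (uncurryOption fun I => G *ᵥ T I) J ≠ 0) (a : α) : J (some a) < σ (J none) := by
  rw [changeFrame_lower h.isUnit_det] at hJ
  obtain ⟨k, hHk, hk⟩ := exists_of_mulVec_ne_zero hJ
  exact (h.lt_of_changeFrame_ne_zero hT hk a).trans_le (h.le_of_conj_ne_zero hHk).1

theorem sum_bruhatWeight_pos (hN : Fintype.card (Option α) < N)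
    (hT : ∀ I k, T I k ≠ 0 → ∀ a, I a < k) {c : α}
    (hskew : ∀ J, uncurryOption (fun I => G *ᵥ T I) (J ∘ Equiv.swap none (some c)) =
      -uncurryOption (fun I => G *ᵥ T I) J)
    {J : Option α → Fin m} (hJ : changeFrame (fun _ => frameMatrix A true)
      (uncurryOption fun I => G *ᵥ T I) J ≠ 0) : 0 < ∑ a, bruhatWeight N σ (J a) := by
  have hlt := h.lt_of_changeFrame_lower_ne_zero hT hJ
  have hltc : J none < σ (J (some c)) := by
    have hJ' := neg_ne_zero.2 hJ
    rw [← changeFrame_neg, ← funext hskew, ← changeFrame_comp_perm (frameMatrix A true)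
      (uncurryOption fun I => G *ᵥ T I)] at hJ'
    simpa using h.lt_of_changeFrame_lower_ne_zero hT hJ' c
  have hsum := sum_pow_lt_sum_pow (p := fun a => (J a : ℕ)) (q := fun a => (σ (J a) : ℕ)) hN
    (Option.rec ⟨some c, hltc⟩ fun a => ⟨none, hlt a⟩)
  simp only [bruhatWeight, Finset.sum_sub_distrib, sub_pos]
  exact mod_cast hsum

theorem boostWeight_pos (hN : Fintype.card (Option α) < N)
    (hT : ∀ I k, T I k ≠ 0 → ∀ a, I a < k) {c : α}
    (hskew : ∀ J, uncurryOption (fun I => G *ᵥ T I) (J ∘ Equiv.swap none (some c)) =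
      -uncurryOption (fun I => G *ᵥ T I) J)
    {I : Option α → Fin m}
    (hI : changeFrame (fun o => frameMatrix A o.isSome) (uncurryOption T) I ≠ 0) :
    0 < boostWeight (bruhatWeight N σ) Option.isSome I := by
  set T' : Fin m → K := fun k => changeFrame (fun o => frameMatrix A o.isSome)
    (uncurryOption T) fun o => o.elim k (I ∘ some)
  set L' : Fin m → K := fun k => changeFrame (fun _ => frameMatrix A true)
    (uncurryOption fun I => G *ᵥ T I) fun o => o.elim k (I ∘ some)
  have hL : L' = (A * G * Aᵀ) *ᵥ T' := funext fun k => changeFrame_lower h.isUnit_det T _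
  have hTL : T' = (A * G * Aᵀ)⁻¹ *ᵥ L' := by
    rw [hL, Matrix.mulVec_mulVec, Matrix.nonsing_inv_mul _ h.isUnit_det_conj, Matrix.one_mulVec]
  have hI' : T' (I none) ≠ 0 := by
    convert hI using 2
    ext o; cases o <;> rfl
  rw [hTL] at hI'
  obtain ⟨k, hHk, hk⟩ := exists_of_mulVec_ne_zero hI'
  have hpos := h.sum_bruhatWeight_pos hN hT hskew hk
  have hle := h.bruhatWeight_add_nonpos hN.bot_lt hHk
  rw [Fintype.sum_option] at hpos
  simp only [boostWeight, Fintype.sum_option, Option.isSome, cond_true, cond_false]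
  simp only [Option.elim, Function.comp_apply] at hpos
  linarith

end IsBruhatFrame

/-! ### Vanishing of the scalar Weyl invariants -/

namespace WeylMonomial

variable (Θ : WeylMonomial)

/-- The factors of a Weyl monomial: `∇^ν R`, `g^{ij}` and `g_{ij}`, in this order. -/
abbrev Factor : Type := Fin Θ.numR ⊕ Fin Θ.numInv ⊕ Fin Θ.numMet

/-- The index slots of a factor. In a curvature factor `none` is the upper slot. -/
def Slot : Θ.Factor → Type
  | .inl s => Option (Fin (3 + Θ.order s))
  | .inr _ => Fin 2

instance : ∀ φ, Fintype (Θ.Slot φ)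
  | .inl s => inferInstanceAs (Fintype (Option (Fin (3 + Θ.order s))))
  | .inr _ => inferInstanceAs (Fintype (Fin 2))

instance : ∀ φ, DecidableEq (Θ.Slot φ)
  | .inl s => inferInstanceAs (DecidableEq (Option (Fin (3 + Θ.order s))))
  | .inr _ => inferInstanceAs (DecidableEq (Fin 2))

/-- Whether a slot holds a lower index. -/
def isLower : ∀ φ, Θ.Slot φ → Bool
  | .inl _ => Option.isSome
  | .inr (.inl _) => fun _ => false
  | .inr (.inr _) => fun _ => true

/-- The sorting of all index slots into lower ones (left) and upper ones (right), with every lower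
slot replaced by the upper slot it is paired with. -/
def slotEquiv : (Σ φ, Θ.Slot φ) ≃
    (Fin Θ.numR ⊕ Fin Θ.numInv × Fin 2) ⊕ (Fin Θ.numR ⊕ Fin Θ.numInv × Fin 2) :=
  Equiv.trans
    { toFun := fun
        | ⟨.inl s, some a⟩ => .inl (.inl ⟨s, a⟩)
        | ⟨.inl s, none⟩ => .inr (.inl s)
        | ⟨.inr (.inl b), a⟩ => .inr (.inr (b, a))
        | ⟨.inr (.inr c), a⟩ => .inl (.inr (c, a))
      invFun := fun
        | .inl (.inl ⟨s, a⟩) => ⟨.inl s, some a⟩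
        | .inr (.inl s) => ⟨.inl s, none⟩
        | .inr (.inr (b, a)) => ⟨.inr (.inl b), a⟩
        | .inl (.inr (c, a)) => ⟨.inr (.inr c), a⟩
      left_inv := by rintro ⟨_ | _ | _, _ | _⟩ <;> rfl
      right_inv := by rintro ((_ | _) | (_ | _)) <;> rfl }
    (Equiv.sumCongr Θ.pairing (Equiv.refl _))

theorem isLeft_slotEquiv : ∀ φ a, (Θ.slotEquiv ⟨φ, a⟩).isLeft = Θ.isLower φ a
  | .inl _, some _ => rfl
  | .inl _, none => rfl
  | .inr (.inl _), _ => rfl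
  | .inr (.inr _), _ => rfl

/-- The components of a factor at the point `x`. -/
noncomputable def factor {m : ℕ} (g : Metric m) (x : E m) : ∀ φ, (Θ.Slot φ → Fin m) → ℝ
  | .inl s => uncurryOption fun I k => nablaR g (Θ.order s) I k x
  | .inr (.inl _) => fun J => (g.toMatrix x)⁻¹ (J (0 : Fin 2)) (J (1 : Fin 2))
  | .inr (.inr _) => fun J => g.toMatrix x (J (0 : Fin 2)) (J (1 : Fin 2))

theorem eval_eq_contraction {m : ℕ} (g : Metric m) (x : E m) :
    Θ.eval g x = contraction Θ.slotEquiv fun J => ∏ φ, Θ.factor g x φ fun a => J ⟨φ, a⟩ := by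
  refine Fintype.sum_congr _ _ fun f => ?_
  beta_reduce
  rw [Fintype.prod_sum_type, Fintype.prod_sum_type, ← mul_assoc]
  rfl

end WeylMonomial

namespace IsGeneralizedPlaneWave

variable {m : ℕ} {g : Metric m} (hg : IsGeneralizedPlaneWave g)

include hg

theorem boostWeight_nablaR_pos {x : E m} {A σ} (h : IsBruhatFrame (g.toMatrix x) A σ) {ν N : ℕ}
    (hN : Fintype.card (Option (Fin (3 + ν))) < N) {I : Option (Fin (3 + ν)) → Fin m}
    (hI : changeFrame (fun o => frameMatrix A o.isSome)
      (uncurryOption fun I k => nablaR g ν I k x) I ≠ 0) :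
    0 < boostWeight (bruhatWeight N σ) Option.isSome I :=
  h.boostWeight_pos (c := Fin.castAdd ν (2 : Fin 3)) hN
    (fun _ _ hk a => not_le.1 fun hle => hk (hg.nablaR_eq_zero ⟨a, hle⟩ x))
    (fun J => isSkewAt_nablaR g ν J x) hI

theorem boostWeight_factor {x : E m} {A σ} (h : IsBruhatFrame (g.toMatrix x) A σ)
    (Θ : WeylMonomial) {N : ℕ} {φ : Θ.Factor} (hN : Fintype.card (Θ.Slot φ) < N)
    {I : Θ.Slot φ → Fin m}
    (hI : changeFrame (fun a => frameMatrix A (Θ.isLower φ a)) (Θ.factor g x φ) I ≠ 0) :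
    0 ≤ boostWeight (bruhatWeight N σ) (Θ.isLower φ) I ∧
      (φ.isLeft → 0 < boostWeight (bruhatWeight N σ) (Θ.isLower φ) I) := by
  match φ with
  | .inl s =>
    have hpos := hg.boostWeight_nablaR_pos h hN hI
    exact ⟨hpos.le, fun _ => hpos⟩
  | .inr (.inl b) =>
    have hH := changeFrame_fin_two (frameMatrix A false) (g.toMatrix x)⁻¹ I
    have hinv : frameMatrix A false * (g.toMatrix x)⁻¹ * (frameMatrix A false).transpose =
        (A * g.toMatrix x * A.transpose)⁻¹ := by
      simp [frameMatrix, Matrix.mul_inv_rev, Matrix.transpose_nonsing_inv, mul_assoc]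
    have hle := h.bruhatWeight_add_nonpos hN.bot_lt (i := I (0 : Fin 2)) (j := I (1 : Fin 2))
      (by rw [← hinv, ← hH]; exact hI)
    refine ⟨?_, nofun⟩
    calc 0 ≤ -bruhatWeight N σ (I (0 : Fin 2)) + -bruhatWeight N σ (I (1 : Fin 2)) := by linarith
      _ = _ := (Fin.sum_univ_two fun a : Fin 2 => -bruhatWeight N σ (I a)).symm
  | .inr (.inr c) =>
    have hH := changeFrame_fin_two (frameMatrix A true) (g.toMatrix x) I
    have hle := h.bruhatWeight_add_nonneg hN.bot_lt (i := I (0 : Fin 2)) (j := I (1 : Fin 2))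
      (ne_of_eq_of_ne hH.symm hI)
    exact ⟨hle.trans_eq (Fin.sum_univ_two fun a : Fin 2 => bruhatWeight N σ (I a)).symm, nofun⟩

theorem isVSI : IsVSI g := by
  intro Θ x
  obtain ⟨A, σ, h⟩ := exists_isBruhatFrame (g.symm x) (g.nondeg x)
  rw [Θ.eval_eq_contraction, ← contraction_changeFrame h.isUnit_det]
  refine contraction_eq_zero (w := bruhatWeight (Fintype.card (Σ φ, Θ.Slot φ) + 1) σ) fun I hI => ?_
  rw [changeFrame_sigma, Finset.prod_ne_zero_iff] at hI
  have hfactor (φ : Θ.Factor) := hg.boostWeight_factor h Θ (φ := φ) (I := fun a => I ⟨φ, a⟩)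
    (Nat.lt_succ_of_le (Fintype.card_le_of_injective (Sigma.mk φ) sigma_mk_injective))
    (by simpa only [Θ.isLeft_slotEquiv] using hI φ (Finset.mem_univ φ))
  simp only [boostWeight, Fintype.sum_sigma, Θ.isLeft_slotEquiv]
  exact Finset.sum_pos' (fun φ _ => (hfactor φ).1)
    ⟨.inl ⟨0, Θ.numR_pos⟩, Finset.mem_univ _, (hfactor _).2 rfl⟩

end IsGeneralizedPlaneWave

/-! ### Triangular systems of ordinary differential equations -/

section ScalarEquations

variable {s : Set ℝ} {f h : ℝ → ℝ}

theorem contDiffOn_derivWithin {F : Type*} [NormedAddCommGroup F] [NormedSpace ℝ F] {f : ℝ → F}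
    (hs : UniqueDiffOn ℝ s) (hf : ContDiffOn ℝ ∞ f s) : ContDiffOn ℝ ∞ (derivWithin f s) s :=
  ((contDiffOn_infty_iff_derivWithin hs).1 hf).2

theorem eqOn_of_derivWithin_eqOn {F : Type*} [NormedAddCommGroup F] [NormedSpace ℝ F]
    {f h : ℝ → F} (hc : Convex ℝ s) (hs : UniqueDiffOn ℝ s) (hf : DifferentiableOn ℝ f s)
    (hh : DifferentiableOn ℝ h s) (hd : Set.EqOn (derivWithin f s) (derivWithin h s) s) {t₀ : ℝ}
    (ht₀ : t₀ ∈ s) (h₀ : f t₀ = h t₀) : Set.EqOn f h s := by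
  refine hc.eqOn_of_fderivWithin_eq (𝕜 := ℝ) hf hh hs (fun t ht => ?_) ht₀ h₀
  ext
  simpa only [derivWithin] using hd ht

theorem exists_primitive (hcl : IsClosed s) (hs : UniqueDiffOn ℝ s) (hf : ContDiffOn ℝ ∞ f s)
    (t₀ a : ℝ) :
    ∃ F : ℝ → ℝ, ContDiffOn ℝ ∞ F s ∧ Set.EqOn (derivWithin F s) f s ∧ F t₀ = a := by
  obtain ⟨h, hh⟩ :=
    ContinuousMap.exists_restrict_eq hcl ⟨s.domRestrict f, hf.continuousOn.domRestrict⟩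
  have hhf (t : ℝ) (ht : t ∈ s) : h t = f t := DFunLike.congr_fun hh ⟨t, ht⟩
  let F (t : ℝ) : ℝ := a + ∫ τ in t₀..t, h τ
  have hF (t : ℝ) (ht : t ∈ s) : HasDerivWithinAt F (f t) s t := hhf t ht ▸
    ((h.continuous.integral_hasStrictDerivAt t₀ t).hasDerivAt.const_add a).hasDerivWithinAt
  have hd : Set.EqOn (derivWithin F s) f s := fun t ht => (hF t ht).derivWithin (hs t ht)
  exact ⟨F, (contDiffOn_infty_iff_derivWithin hs).2
    ⟨fun t ht => (hF t ht).differentiableWithinAt, hf.congr hd⟩, hd, by simp [F]⟩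

theorem exists_second_primitive (hcl : IsClosed s) (hs : UniqueDiffOn ℝ s)
    (hf : ContDiffOn ℝ ∞ f s) {t₀ : ℝ} (ht₀ : t₀ ∈ s) (a b : ℝ) :
    ∃ F : ℝ → ℝ, ContDiffOn ℝ ∞ F s ∧ Set.EqOn (derivWithin (derivWithin F s) s) f s ∧
      F t₀ = a ∧ derivWithin F s t₀ = b := by
  obtain ⟨D, hD, hDf, hD₀⟩ := exists_primitive hcl hs hf t₀ b
  obtain ⟨F, hF, hFD, hF₀⟩ := exists_primitive hcl hs hD t₀ a
  exact ⟨F, hF, fun t ht => (derivWithin_congr hFD (hFD ht)).trans (hDf ht), hF₀,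
    (hFD ht₀).trans hD₀⟩

theorem contDiffOn_add_mul_id (hf : ContDiffOn ℝ ∞ f s) (b : ℝ) :
    ContDiffOn ℝ ∞ (fun t => f t + b * t) s :=
  hf.add (contDiffOn_const.mul contDiffOn_id)

theorem derivWithin_add_mul_id (hs : UniqueDiffOn ℝ s) (hf : DifferentiableOn ℝ f s) (b : ℝ) :
    Set.EqOn (derivWithin (fun t => f t + b * t) s) (fun t => derivWithin f s t + b) s := by
  intro t ht
  have hlin : HasDerivWithinAt (fun t : ℝ => b * t) b s t := by
    simpa using (hasDerivWithinAt_id t s).const_mul b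
  exact ((hf t ht).hasDerivWithinAt.add hlin).derivWithin (hs t ht)

theorem second_derivWithin_add_mul_id (hs : UniqueDiffOn ℝ s) (hf : DifferentiableOn ℝ f s)
    (b : ℝ) : Set.EqOn (derivWithin (derivWithin (fun t => f t + b * t) s) s)
      (derivWithin (derivWithin f s) s) s := by
  intro t ht
  have hd := derivWithin_add_mul_id hs hf b
  rw [derivWithin_congr hd (hd ht), derivWithin_add_const]

theorem exists_second_primitive_of_boundary (hcl : IsClosed s) (hs : UniqueDiffOn ℝ s)
    (hf : ContDiffOn ℝ ∞ f s) (h0 : 0 ∈ s) (a b : ℝ) :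
    ∃ F : ℝ → ℝ, ContDiffOn ℝ ∞ F s ∧ Set.EqOn (derivWithin (derivWithin F s) s) f s ∧
      F 0 = a ∧ F 1 = b := by
  obtain ⟨F, hF, hFf, hF0, -⟩ := exists_second_primitive hcl hs hf h0 a 0
  have hdiff := hF.differentiableOn (by simp)
  exact ⟨fun t => F t + (b - F 1) * t, contDiffOn_add_mul_id hF _,
    (second_derivWithin_add_mul_id hs hdiff _).trans hFf, by simp [hF0], by simp⟩

theorem eqOn_of_second_derivWithin_eqOn (hc : Convex ℝ s) (hs : UniqueDiffOn ℝ s)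
    (hf : ContDiffOn ℝ ∞ f s) (hh : ContDiffOn ℝ ∞ h s)
    (hd : Set.EqOn (derivWithin (derivWithin f s) s) (derivWithin (derivWithin h s) s) s) {t₀ : ℝ}
    (ht₀ : t₀ ∈ s) (h₀ : f t₀ = h t₀) (h₁ : derivWithin f s t₀ = derivWithin h s t₀) :
    Set.EqOn f h s := by
  have hdiff {f : ℝ → ℝ} (hf : ContDiffOn ℝ ∞ f s) := hf.differentiableOn (by simp)
  have hd' : Set.EqOn (derivWithin f s) (derivWithin h s) s :=
    eqOn_of_derivWithin_eqOn hc hs (hdiff (contDiffOn_derivWithin hs hf))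
      (hdiff (contDiffOn_derivWithin hs hh)) hd ht₀ h₁
  exact eqOn_of_derivWithin_eqOn hc hs (hdiff hf) (hdiff hh) hd' ht₀ h₀

theorem eqOn_of_second_derivWithin_eqOn_of_boundary (hc : Convex ℝ s) (hs : UniqueDiffOn ℝ s)
    (hf : ContDiffOn ℝ ∞ f s) (hh : ContDiffOn ℝ ∞ h s)
    (hd : Set.EqOn (derivWithin (derivWithin f s) s) (derivWithin (derivWithin h s) s) s)
    (hs0 : 0 ∈ s) (hs1 : 1 ∈ s) (h0 : f 0 = h 0) (h1 : f 1 = h 1) : Set.EqOn f h s := by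
  set b := derivWithin f s 0 - derivWithin h s 0 with hb
  have hdiff := hh.differentiableOn (by simp)
  have hlin : Set.EqOn f (fun t => h t + b * t) s :=
    eqOn_of_second_derivWithin_eqOn hc hs hf (contDiffOn_add_mul_id hh b)
      (hd.trans (second_derivWithin_add_mul_id hs hdiff b).symm) hs0 (by simp [h0])
      (by rw [derivWithin_add_mul_id hs hdiff b hs0, hb]; ring)
  have hb0 : b = 0 := by
    have := hlin hs1
    simp only [mul_one] at this
    linarith
  simpa only [hb0, zero_mul, add_zero] using hlin

end ScalarEquations

theorem exists_forall_of_local {ι α : Type*} [LT ι] [WellFoundedLT ι] [Nonempty α]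
    {Rel : ι → (ι → α) → α → Prop}
    (hloc : ∀ k X Y c, (∀ i < k, X i = Y i) → Rel k X c → Rel k Y c)
    (hex : ∀ k X, ∃ c, Rel k X c) : ∃ X : ι → α, ∀ k, Rel k X (X k) := by
  classical
  choose sol hsol using hex
  let extend (k : ι) (X : ∀ i, i < k → α) (i : ι) : α :=
    if hi : i < k then X i hi else Classical.arbitrary α
  let X : ι → α := WellFoundedLT.fix fun k ih => sol k (extend k ih)
  refine ⟨X, fun k => ?_⟩
  have hX : X k = sol k (extend k fun i _ => X i) := WellFoundedLT.fix_eq _ k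
  exact hX ▸ hloc k _ _ _ (fun i hi => dif_pos hi) (hsol k _)

section TriangularSystems

variable {s : Set ℝ} {F : Fin m → (ℝ → E m) → ℝ → ℝ}

/-- The right-hand sides of a system of ordinary differential equations on `s` that can be solved
one component at a time: `F k` takes smooth curves to smooth functions, and it involves only the
components before the `k`-th. -/
structure IsTriangularSystem (s : Set ℝ) (F : Fin m → (ℝ → E m) → ℝ → ℝ) : Prop where
  contDiffOn ⦃X : ℝ → E m⦄ (hX : ContDiffOn ℝ ∞ X s) (k : Fin m) : ContDiffOn ℝ ∞ (F k X) s
  eqOn ⦃X Y : ℝ → E m⦄ (hX : ContDiffOn ℝ ∞ X s) (hY : ContDiffOn ℝ ∞ Y s) (k : Fin m)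
    (hXY : ∀ i < k, Set.EqOn (X · i) (Y · i) s) : Set.EqOn (F k X) (F k Y) s

namespace IsTriangularSystem

/-- The differential operator `L` and the boundary conditions `BC` are left arbitrary: they are of
first order for parallel fields and of second order for geodesics. -/
theorem exists_solution (hF : IsTriangularSystem s F) {L : (ℝ → ℝ) → ℝ → ℝ}
    {BC : Fin m → (ℝ → ℝ) → Prop}
    (hsolve : ∀ k f, ContDiffOn ℝ ∞ f s →
      ∃ c, ContDiffOn ℝ ∞ c s ∧ Set.EqOn (L c) f s ∧ BC k c) :
    ∃ X : ℝ → E m, ContDiffOn ℝ ∞ X s ∧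
      (∀ k, Set.EqOn (L (X · k)) (F k X) s) ∧ ∀ k, BC k (X · k) := by
  let curve (X : Fin m → {c : ℝ → ℝ // ContDiffOn ℝ ∞ c s}) (t : ℝ) : E m := fun k => (X k).1 t
  have hcurve X : ContDiffOn ℝ ∞ (curve X) s := contDiffOn_pi.2 fun k => (X k).2
  have : Nonempty {c : ℝ → ℝ // ContDiffOn ℝ ∞ c s} := ⟨0, contDiffOn_const⟩
  have hlocal k X Y (hXY : ∀ i < k, X i = Y i) :
      Set.EqOn (F k (curve X)) (F k (curve Y)) s :=
    hF.eqOn (hcurve X) (hcurve Y) k fun i hi t _ => congrArg (·.1 t) (hXY i hi)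
  obtain ⟨X, hX⟩ := exists_forall_of_local
    (Rel := fun k X (c : {c : ℝ → ℝ // ContDiffOn ℝ ∞ c s}) =>
      Set.EqOn (L c.1) (F k (curve X)) s ∧ BC k c.1)
    (fun k X Y c hXY hc => ⟨hc.1.trans (hlocal k X Y hXY), hc.2⟩)
    (fun k X => by
      obtain ⟨c, hc, heq, hbc⟩ := hsolve k _ (hF.contDiffOn (hcurve X) k)
      exact ⟨⟨c, hc⟩, heq, hbc⟩)
  exact ⟨curve X, hcurve X, fun k => (hX k).1, fun k => (hX k).2⟩

theorem eqOn_solution (hF : IsTriangularSystem s F) {L : (ℝ → ℝ) → ℝ → ℝ} {X Y : ℝ → E m}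
    (hX : ContDiffOn ℝ ∞ X s) (hY : ContDiffOn ℝ ∞ Y s)
    (hXF : ∀ k, Set.EqOn (L (X · k)) (F k X) s) (hYF : ∀ k, Set.EqOn (L (Y · k)) (F k Y) s)
    (hunique : ∀ k, Set.EqOn (L (X · k)) (L (Y · k)) s → Set.EqOn (X · k) (Y · k) s) :
    Set.EqOn X Y s := by
  have hcomponent (k : Fin m) : Set.EqOn (X · k) (Y · k) s := by
    induction k using WellFoundedLT.induction with
    | _ k ih => exact hunique k ((hXF k).trans ((hF.eqOn hX hY k ih).trans (hYF k).symm))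
  exact fun t ht => funext fun k => hcomponent k ht

end IsTriangularSystem

end TriangularSystems

section Curves

variable {s : Set ℝ} {g : Metric m}

theorem contDiffOn_component {X : ℝ → E m} (hX : ContDiffOn ℝ ∞ X s) (k : Fin m) :
    ContDiffOn ℝ ∞ (X · k) s := contDiffOn_pi.1 hX k

theorem derivWithin_component {X : ℝ → E m} (hX : ContDiffOn ℝ ∞ X s) (k : Fin m) :
    Set.EqOn (derivWithin X s · k) (derivWithin (X · k) s) s := fun t ht => by
  beta_reduce
  rw [derivWithin_pi fun i => (contDiffOn_component hX i).differentiableOn (by simp) t ht]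

/-- The bilinear form `(u, v) ↦ ∑ i j, Γ_{ij}^k(x) u_i v_j` (with values indexed by `k`), by which
`∇` differs from the flat connection. -/
noncomputable def christoffelForm (g : Metric m) (x u v : E m) : E m := fun k =>
  ∑ i, ∑ j, christoffel g i j k x * u i * v j

theorem christoffelForm_add (x u v w : E m) :
    christoffelForm g x u (v + w) = christoffelForm g x u v + christoffelForm g x u w :=
  funext fun k => by simp only [christoffelForm, Pi.add_apply, mul_add, Finset.sum_add_distrib]

theorem christoffelForm_smul (x u v : E m) (c : ℝ) :
    christoffelForm g x u (c • v) = c • christoffelForm g x u v :=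
  funext fun k => by
    simp only [christoffelForm, Pi.smul_apply, smul_eq_mul, Finset.mul_sum, mul_left_comm _ c]

theorem contDiffOn_christoffelForm {x u v : ℝ → E m} (hx : ContDiffOn ℝ ∞ x s)
    (hu : ContDiffOn ℝ ∞ u s) (hv : ContDiffOn ℝ ∞ v s) (k : Fin m) :
    ContDiffOn ℝ ∞ (fun t => christoffelForm g (x t) (u t) (v t) k) s :=
  ContDiffOn.sum fun i _ => ContDiffOn.sum fun j _ =>
    (((contDiff_christoffel g i j k).comp_contDiffOn hx).mul (contDiffOn_component hu i)).mul
      (contDiffOn_component hv j)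

theorem covDerivAlong_eq_zero_iff {γ X : ℝ → E m} {t : ℝ} :
    covDerivAlong g γ X s t = 0 ↔
      derivWithin X s t = -christoffelForm g (γ t) (derivWithin γ s t) (X t) :=
  add_eq_zero_iff_eq_neg (a := derivWithin X s t)

theorem IsParallelOn.add {γ X Y : ℝ → E m} (hX : IsParallelOn g γ X s)
    (hY : IsParallelOn g γ Y s) : IsParallelOn g γ (fun t => X t + Y t) s := by
  refine ⟨hX.1.add hY.1, fun t ht => covDerivAlong_eq_zero_iff.2 ?_⟩
  rw [derivWithin_fun_add (hX.1.differentiableOn (by simp) t ht)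
    (hY.1.differentiableOn (by simp) t ht), covDerivAlong_eq_zero_iff.1 (hX.2 t ht),
    covDerivAlong_eq_zero_iff.1 (hY.2 t ht), christoffelForm_add, neg_add]

theorem IsParallelOn.const_smul {γ X : ℝ → E m} (hX : IsParallelOn g γ X s) (c : ℝ) :
    IsParallelOn g γ (fun t => c • X t) s := by
  refine ⟨hX.1.const_smul c, fun t ht => covDerivAlong_eq_zero_iff.2 ?_⟩
  rw [derivWithin_fun_const_smul c (hX.1.differentiableOn (by simp) t ht),
    covDerivAlong_eq_zero_iff.1 (hX.2 t ht), christoffelForm_smul, smul_neg]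

theorem IsGeodesicOn.mono {γ : ℝ → E m} {s' : Set ℝ} (hγ : IsGeodesicOn g γ s')
    (hs' : UniqueDiffOn ℝ s') (hs : UniqueDiffOn ℝ s) (hss' : s ⊆ s') : IsGeodesicOn g γ s := by
  have hsubset {c : ℝ → E m} (hc : ContDiffOn ℝ ∞ c s') :
      Set.EqOn (derivWithin c s) (derivWithin c s') s := fun t ht =>
    derivWithin_subset hss' (hs t ht) (hc.differentiableOn (by simp) t (hss' ht))
  refine ⟨hγ.1.mono hss', fun t ht => covDerivAlong_eq_zero_iff.2 ?_⟩
  have hd := hsubset hγ.1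
  rw [derivWithin_congr hd (hd ht), hsubset (contDiffOn_derivWithin hs' hγ.1) ht, hd ht]
  exact covDerivAlong_eq_zero_iff.1 (hγ.2 t (hss' ht))

theorem isParallelOn_iff {γ X : ℝ → E m} : IsParallelOn g γ X s ↔ ContDiffOn ℝ ∞ X s ∧
    ∀ k, Set.EqOn (derivWithin (X · k) s)
      (fun t => -christoffelForm g (γ t) (derivWithin γ s t) (X t) k) s := by
  refine and_congr_right fun hX => ?_
  exact ⟨fun h k t ht => (derivWithin_component hX k ht).symm.trans
      congr($(covDerivAlong_eq_zero_iff.1 (h t ht)) k),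
    fun h t ht => covDerivAlong_eq_zero_iff.2 <| funext fun k =>
      (derivWithin_component hX k ht).trans (h k ht)⟩

theorem isGeodesicOn_iff (hs : UniqueDiffOn ℝ s) {γ : ℝ → E m} :
    IsGeodesicOn g γ s ↔ ContDiffOn ℝ ∞ γ s ∧
      ∀ k, Set.EqOn (derivWithin (derivWithin (γ · k) s) s)
        (fun t => -christoffelForm g (γ t) (derivWithin γ s t) (derivWithin γ s t) k) s := by
  refine and_congr_right fun hγ => ?_
  have hγ' := contDiffOn_derivWithin hs hγ
  have hcongr (k : Fin m) : Set.EqOn (derivWithin (derivWithin γ s · k) s)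
      (derivWithin (derivWithin (γ · k) s) s) s := fun t ht =>
    derivWithin_congr (derivWithin_component hγ k) (derivWithin_component hγ k ht)
  have hparallel := isParallelOn_iff (g := g) (γ := γ) (X := derivWithin γ s) (s := s)
  rw [IsParallelOn, and_iff_right hγ', and_iff_right hγ'] at hparallel
  exact hparallel.trans (forall_congr' fun k => ⟨(hcongr k).symm.trans, (hcongr k).trans⟩)

end Curves

namespace IsGeneralizedPlaneWave

variable {s : Set ℝ} {g : Metric m} (hg : IsGeneralizedPlaneWave g)
include hg

theorem christoffelForm_congr {k : Fin m} {x y u u' v v' : E m} (hxy : ∀ i < k, x i = y i)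
    (hu : ∀ i < k, u i = u' i) (hv : ∀ i < k, v i = v' i) :
    christoffelForm g x u v k = christoffelForm g y u' v' k := by
  refine Finset.sum_congr rfl fun i _ => Finset.sum_congr rfl fun j _ => ?_
  obtain hij | hij := le_or_gt k (max i j)
  · simp only [(hg i j k).1 hij, zero_mul]
  · obtain ⟨hi, hj⟩ := max_lt_iff.1 hij
    rw [(hg i j k).2 x y hxy, hu i hi, hv j hj]

theorem isTriangularSystem_geodesic (hs : UniqueDiffOn ℝ s) : IsTriangularSystem s
    fun k X t => -christoffelForm g (X t) (derivWithin X s t) (derivWithin X s t) k where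
  contDiffOn X hX k := by
    have hX' := contDiffOn_derivWithin hs hX
    exact (contDiffOn_christoffelForm hX hX' hX' k).neg
  eqOn X Y hX hY k hXY t ht := by
    have hderiv (i : Fin m) (hi : i < k) : derivWithin X s t i = derivWithin Y s t i :=
      (derivWithin_component hX i ht).trans <|
        (derivWithin_congr (hXY i hi) (hXY i hi ht)).trans (derivWithin_component hY i ht).symm
    exact congrArg _ (hg.christoffelForm_congr (fun i hi => hXY i hi ht) hderiv hderiv)

theorem isTriangularSystem_parallel (hs : UniqueDiffOn ℝ s) {γ : ℝ → E m}
    (hγ : ContDiffOn ℝ ∞ γ s) : IsTriangularSystem s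
      fun k X t => -christoffelForm g (γ t) (derivWithin γ s t) (X t) k where
  contDiffOn _ hX k := (contDiffOn_christoffelForm hγ (contDiffOn_derivWithin hs hγ) hX k).neg
  eqOn _ _ _ _ _ hXY _ ht := congrArg _ <|
    hg.christoffelForm_congr (fun _ _ => rfl) (fun _ _ => rfl) fun i hi => hXY i hi ht

/-! ### Geodesics -/

theorem exists_isGeodesicOn (hs : UniqueDiffOn ℝ s) {BC : Fin m → (ℝ → ℝ) → Prop}
    (hsolve : ∀ k f, ContDiffOn ℝ ∞ f s → ∃ c, ContDiffOn ℝ ∞ c s ∧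
      Set.EqOn (derivWithin (derivWithin c s) s) f s ∧ BC k c) :
    ∃ γ : ℝ → E m, IsGeodesicOn g γ s ∧ ∀ k, BC k (γ · k) := by
  obtain ⟨γ, hγ, heq, hBC⟩ := (hg.isTriangularSystem_geodesic hs).exists_solution
    (L := fun c => derivWithin (derivWithin c s) s) hsolve
  exact ⟨γ, (isGeodesicOn_iff hs).2 ⟨hγ, heq⟩, hBC⟩

theorem eqOn_of_isGeodesicOn (hs : UniqueDiffOn ℝ s) {γ γ' : ℝ → E m} (hγ : IsGeodesicOn g γ s)
    (hγ' : IsGeodesicOn g γ' s)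
    (hunique : ∀ k, Set.EqOn (derivWithin (derivWithin (γ · k) s) s)
      (derivWithin (derivWithin (γ' · k) s) s) s → Set.EqOn (γ · k) (γ' · k) s) :
    Set.EqOn γ γ' s :=
  (hg.isTriangularSystem_geodesic hs).eqOn_solution
    (L := fun c => derivWithin (derivWithin c s) s) hγ.1 hγ'.1 ((isGeodesicOn_iff hs).1 hγ).2
    ((isGeodesicOn_iff hs).1 hγ').2 hunique

theorem isComplete : IsComplete g := by
  intro I γ hI hIc hγ
  have hs : UniqueDiffOn ℝ I := hI.uniqueDiffOn
  obtain ⟨t₀, ht₀⟩ : ∃ t₀, I.Nonempty → t₀ ∈ I :=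
    ⟨Classical.epsilon (· ∈ I), fun h => Classical.epsilon_spec h⟩
  obtain ⟨γ', hγ', hinit⟩ := hg.exists_isGeodesicOn uniqueDiffOn_univ fun k f hf =>
    exists_second_primitive isClosed_univ uniqueDiffOn_univ hf (Set.mem_univ t₀) (γ t₀ k)
      (derivWithin (γ · k) I t₀)
  refine ⟨γ', hγ', fun t ht => ?_⟩
  specialize ht₀ ⟨t, ht⟩
  have hγ'I : IsGeodesicOn g γ' I := hγ'.mono uniqueDiffOn_univ hs (Set.subset_univ I)
  refine hg.eqOn_of_isGeodesicOn hs hγ hγ'I (fun k hk => ?_) ht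
  refine eqOn_of_second_derivWithin_eqOn hIc.convex hs (contDiffOn_component hγ.1 k)
    (contDiffOn_component hγ'I.1 k) hk ht₀ (hinit k).1.symm ((hinit k).2.symm.trans ?_)
  exact (derivWithin_subset (Set.subset_univ I) (hs t₀ ht₀)
    ((contDiffOn_component hγ'.1 k).differentiableOn (by simp) t₀ (Set.mem_univ t₀))).symm

theorem isStronglyGeodesicallyConvex : IsStronglyGeodesicallyConvex g := by
  intro P Q
  have hs : UniqueDiffOn ℝ (Set.Icc (0 : ℝ) 1) := uniqueDiffOn_Icc zero_lt_one
  have h0 : (0 : ℝ) ∈ Set.Icc (0 : ℝ) 1 := Set.left_mem_Icc.2 zero_le_one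
  have h1 : (1 : ℝ) ∈ Set.Icc (0 : ℝ) 1 := Set.right_mem_Icc.2 zero_le_one
  obtain ⟨γ, hγ, hbd⟩ := hg.exists_isGeodesicOn hs fun k f hf =>
    exists_second_primitive_of_boundary isClosed_Icc hs hf h0 (P k) (Q k)
  refine ⟨γ, ⟨hγ, funext fun k => (hbd k).1, funext fun k => (hbd k).2⟩, fun γ' hγ' hP hQ => ?_⟩
  exact hg.eqOn_of_isGeodesicOn hs hγ' hγ fun k hk =>
    eqOn_of_second_derivWithin_eqOn_of_boundary (convex_Icc 0 1) hs (contDiffOn_component hγ'.1 k)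
      (contDiffOn_component hγ.1 k) hk h0 h1 (congr($hP k).trans (hbd k).1.symm)
      (congr($hQ k).trans (hbd k).2.symm)

/-! ### Parallel transport and holonomy -/

theorem exists_isParallelOn (hcl : IsClosed s) (hs : UniqueDiffOn ℝ s) {γ : ℝ → E m}
    (hγ : ContDiffOn ℝ ∞ γ s) (t₀ : ℝ) (v : E m) :
    ∃ X : ℝ → E m, IsParallelOn g γ X s ∧ X t₀ = v := by
  obtain ⟨X, hX, heq, hinit⟩ := (hg.isTriangularSystem_parallel hs hγ).exists_solution
    (L := (derivWithin · s)) fun k f hf => exists_primitive hcl hs hf t₀ (v k)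
  exact ⟨X, isParallelOn_iff.2 ⟨hX, heq⟩, funext hinit⟩

theorem eqOn_of_isParallelOn (hc : Convex ℝ s) (hs : UniqueDiffOn ℝ s) {γ X Y : ℝ → E m}
    (hγ : ContDiffOn ℝ ∞ γ s) (hX : IsParallelOn g γ X s) (hY : IsParallelOn g γ Y s) {t₀ : ℝ}
    (ht₀ : t₀ ∈ s) (h₀ : X t₀ = Y t₀) : Set.EqOn X Y s := by
  refine (hg.isTriangularSystem_parallel hs hγ).eqOn_solution (L := (derivWithin · s)) hX.1 hY.1
    (isParallelOn_iff.1 hX).2 (isParallelOn_iff.1 hY).2 fun k hk => ?_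
  exact eqOn_of_derivWithin_eqOn hc hs ((contDiffOn_component hX.1 k).differentiableOn (by simp))
    ((contDiffOn_component hY.1 k).differentiableOn (by simp)) hk ht₀ congr($h₀ k)

theorem exists_isParallelTransport {γ : ℝ → E m} (hγ : IsSmoothCurve γ) :
    ∃ P : E m ≃ₗ[ℝ] E m, IsParallelTransport g γ P := by
  have hs : UniqueDiffOn ℝ (Set.Icc (0 : ℝ) 1) := uniqueDiffOn_Icc zero_lt_one
  have h0 : (0 : ℝ) ∈ Set.Icc (0 : ℝ) 1 := Set.left_mem_Icc.2 zero_le_one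
  have h1 : (1 : ℝ) ∈ Set.Icc (0 : ℝ) 1 := Set.right_mem_Icc.2 zero_le_one
  choose X hX hX0 using fun v => hg.exists_isParallelOn isClosed_Icc hs hγ 0 v
  have hunique {v Y} (hY : IsParallelOn g γ Y (Set.Icc 0 1)) (hY0 : Y 0 = v) : X v 1 = Y 1 :=
    hg.eqOn_of_isParallelOn (convex_Icc 0 1) hs hγ (hX v) hY h0 ((hX0 v).trans hY0.symm) h1
  let P : E m →ₗ[ℝ] E m :=
    { toFun := fun v => X v 1
      map_add' := fun v w => hunique ((hX v).add (hX w)) congr($(hX0 v) + $(hX0 w))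
      map_smul' := fun c v => hunique ((hX v).const_smul c) congr(c • $(hX0 v)) }
  have hinj : Function.Injective P := fun v w hvw => by
    simpa only [hX0] using
      hg.eqOn_of_isParallelOn (convex_Icc 0 1) hs hγ (hX v) (hX w) h1 hvw h0
  refine ⟨LinearEquiv.ofInjectiveEndo P hinj, fun v w => ⟨?_, fun h => ⟨X v, hX v, hX0 v, h⟩⟩⟩
  rintro ⟨Y, hY, hY0, rfl⟩
  exact hunique hY hY0

end IsGeneralizedPlaneWave

/-- The linear automorphisms that preserve the flag of the spaces `{v | ∀ i < k, v i = 0}` and act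
trivially on its successive quotients. -/
def flagUnipotent (R ι : Type*) [Semiring R] [Preorder ι] [WellFoundedLT ι] :
    Subgroup ((ι → R) ≃ₗ[R] (ι → R)) where
  carrier := {A | ∀ k v, (∀ i < k, v i = 0) → A v k = v k}
  mul_mem' {A B} hA hB k v hv := by
    have hBv : ∀ i < k, B v i = 0 := fun i hi =>
      (hB i v fun j hj => hv j (hj.trans hi)).trans (hv i hi)
    exact (hA k (B v) hBv).trans (hB k v hv)
  one_mem' _ _ _ := rfl
  inv_mem' {A} hA k v := by
    have hAinv : A (A⁻¹ v) = v := A.apply_symm_apply v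
    induction k using WellFoundedLT.induction with
    | _ k ih =>
      intro hv
      have hzero : ∀ i < k, A⁻¹ v i = 0 := fun i hi =>
        (ih i hi fun j hj => hv j (hj.trans hi)).trans (hv i hi)
      exact (hA k _ hzero).symm.trans congr($hAinv k)

theorem sum_smul_basisVec (v : E m) : ∑ j, v j • basisVec j = v := by
  simp only [basisVec, ← Pi.single_smul', smul_eq_mul, mul_one, Finset.univ_sum_single]

theorem apply_basisVec_of_mem_flagUnipotent {A : E m ≃ₗ[ℝ] E m}
    (hA : A ∈ flagUnipotent ℝ (Fin m)) {i k : Fin m} (hk : k ≤ i) :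
    A (basisVec i) k = basisVec i k :=
  hA k _ fun _ hj => Pi.single_eq_of_ne (hj.trans_le hk).ne 1

theorem exists_apply_basisVec_eq_add_sum {A : E m ≃ₗ[ℝ] E m} (hA : A ∈ flagUnipotent ℝ (Fin m))
    (i : Fin m) :
    ∃ a : Fin m → ℝ, A (basisVec i) = basisVec i + ∑ j ∈ Finset.Ioi i, a j • basisVec j := by
  refine ⟨A (basisVec i), funext fun k => ?_⟩
  have hsum : (∑ j ∈ Finset.Ioi i, A (basisVec i) j • basisVec j) k =
      if i < k then A (basisVec i) k else 0 := by
    simp [Finset.sum_apply, basisVec, Pi.single_apply]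
  rw [Pi.add_apply, hsum]
  split_ifs with hk
  · rw [basisVec, Pi.single_eq_of_ne hk.ne', zero_add]
  · rw [add_zero, apply_basisVec_of_mem_flagUnipotent hA (not_lt.1 hk)]

theorem exists_mem_upperUnipotent_apply_basisVec_eq {A : E m ≃ₗ[ℝ] E m}
    (hA : A ∈ flagUnipotent ℝ (Fin m)) :
    ∃ T ∈ upperUnipotent m, ∀ i, A (basisVec i) = ∑ j, T.val i j • basisVec j := by
  have hrow {i k : Fin m} (hk : k ≤ i) := apply_basisVec_of_mem_flagUnipotent hA hk
  obtain ⟨T, hT, hval⟩ :=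
    exists_mem_upperUnipotent_val_eq (T := Matrix.of fun i j => A (basisVec i) j)
      (fun i j hji => (hrow (le_of_lt hji)).trans (Pi.single_eq_of_ne hji.ne 1))
      (fun i => (hrow le_rfl).trans (Pi.single_eq_same i 1))
  exact ⟨T, hT, fun i => by simp only [hval, Matrix.of_apply, sum_smul_basisVec]⟩

namespace IsGeneralizedPlaneWave

variable {s : Set ℝ} {g : Metric m} (hg : IsGeneralizedPlaneWave g)
include hg

theorem apply_eq_of_isParallelOn (hc : Convex ℝ s) (hs : UniqueDiffOn ℝ s) {γ X : ℝ → E m}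
    (hX : IsParallelOn g γ X s) {t₀ : ℝ} (ht₀ : t₀ ∈ s) {k : Fin m} (h₀ : ∀ i < k, X t₀ i = 0) :
    ∀ t ∈ s, X t k = X t₀ k := by
  induction k using WellFoundedLT.induction with
  | _ k ih =>
    have hzero (t : ℝ) (ht : t ∈ s) (i : Fin m) (hi : i < k) : X t i = 0 :=
      (ih i hi (fun j hj => h₀ j (hj.trans hi)) t ht).trans (h₀ i hi)
    refine eqOn_of_derivWithin_eqOn (h := fun _ => X t₀ k) hc hs
      ((contDiffOn_component hX.1 k).differentiableOn (by simp)) (differentiableOn_const _)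
      (fun t ht => ?_) ht₀ rfl
    rw [(isParallelOn_iff.1 hX).2 k ht, derivWithin_fun_const, Pi.zero_apply, neg_eq_zero,
      hg.christoffelForm_congr (v' := 0) (fun _ _ => rfl) (fun _ _ => rfl) (hzero t ht)]
    simp only [christoffelForm, Pi.zero_apply, mul_zero, Finset.sum_const_zero]

theorem mem_flagUnipotent {γ : ℝ → E m} {P : E m ≃ₗ[ℝ] E m} (hP : IsParallelTransport g γ P) :
    P ∈ flagUnipotent ℝ (Fin m) := by
  intro k v hv
  obtain ⟨X, hX, rfl, hX1⟩ := (hP v (P v)).2 rfl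
  exact hX1 ▸ hg.apply_eq_of_isParallelOn (convex_Icc 0 1) (uniqueDiffOn_Icc zero_lt_one) hX
    (Set.left_mem_Icc.2 zero_le_one) hv 1 (Set.right_mem_Icc.2 zero_le_one)

theorem holonomyGroup_le_flagUnipotent (p : E m) :
    holonomyGroup g p ≤ flagUnipotent ℝ (Fin m) :=
  (Subgroup.closure_le _).2 fun _ ⟨_, _, _, _, hP⟩ => hg.mem_flagUnipotent hP

end IsGeneralizedPlaneWave

end GPW

theorem theorem1p1 (m : ℕ) (g : GPW.Metric m) (hg : GPW.IsGeneralizedPlaneWave g) :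
    (GPW.IsComplete g ∧ GPW.IsStronglyGeodesicallyConvex g) ∧
    (∀ (ν : ℕ) (I : Fin (3 + ν) → Fin m) (k : Fin m),
      ((∃ a, k ≤ I a) → ∀ x, GPW.nablaR g ν I k x = 0) ∧
      GPW.DependsOnlyBelow k (GPW.nablaR g ν I k)) ∧
    (GPW.IsNilpotentOsserman g ∧ GPW.IsNilpotentIvanovPetrova g ∧ GPW.IsNilpotentSzabo g) ∧
    (GPW.IsRicciFlat g ∧ GPW.IsEinstein g) ∧
    GPW.IsVSI g ∧
    (∀ γ : ℝ → GPW.E m, GPW.IsSmoothCurve γ →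
      ∃ P : GPW.E m ≃ₗ[ℝ] GPW.E m, GPW.IsParallelTransport g γ P ∧
        ∀ i : Fin m, ∃ a : Fin m → ℝ,
          P (GPW.basisVec i) = GPW.basisVec i + ∑ j ∈ Finset.Ioi i, a j • GPW.basisVec j) ∧
    (Group.IsNilpotent (GPW.upperUnipotent m) ∧
      ∀ (p : GPW.E m), ∀ A ∈ GPW.holonomyGroup g p, ∃ T ∈ GPW.upperUnipotent m,
        ∀ i : Fin m, A (GPW.basisVec i) = ∑ j, T.val i j • GPW.basisVec j) := by
  refine ⟨⟨hg.isComplete, hg.isStronglyGeodesicallyConvex⟩,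
    fun ν I k => ⟨fun h x => hg.nablaR_eq_zero h x, (hg.isTriangularAt_nablaR ν I k).2⟩,
    ⟨hg.isNilpotentOsserman, hg.isNilpotentIvanovPetrova, hg.isNilpotentSzabo⟩,
    ⟨hg.isRicciFlat, hg.isEinstein⟩, hg.isVSI, fun γ hγ => ?_,
    GPW.isNilpotent_upperUnipotent m, fun p A hA => ?_⟩
  · obtain ⟨P, hP⟩ := hg.exists_isParallelTransport hγ
    exact ⟨P, hP, GPW.exists_apply_basisVec_eq_add_sum (hg.mem_flagUnipotent hP)⟩
  · exact GPW.exists_mem_upperUnipotent_apply_basisVec_eq (hg.holonomyGroup_le_flagUnipotent p hA)
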